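/- Let $F$ be a finite field with $q$ elements, let each element of $F$ be encoded by its own binary word of length $\lceil\log_2 q\rceil$ (by an arbitrary injective code), and let $r$ be a polynomial with coefficients in $\mathbb{N}$ (for example $r(d)=c\,d^k$). MIN-PM over $F$ is the following optimization problem. Its instances are the pairs $(P,n)$, where $P\in F[x]$ is a nonzero polynomial and $n$ is an integer with $\deg P<n\le r(\deg P)$; $P$ is encoded by the list of its $\deg P+1$ coefficients and $n$ in binary, so that the size of $(P,n)$ is $(\deg P+1)\log q+\log n$ up to a constant factor. The feasible solutions of $(P,n)$ are the nonzero polynomials $K\in F[x]$ with $\deg K<n$ and $P\mid K$; the measure of $K$ is its Hamming weight (number of nonzero coefficients), which is to be minimized. Write $\mu^*(P,n)$ for the minimum. The constructive version MIN-PM$_C$ asks, given $(P,n)$, for an optimal solution and its measure; the evaluation version MIN-PM$_E$ asks, given $(P,n)$, for $\mu^*(P,n)$; the decision version MIN-PM$_D$ asks, given $(P,n)$ and a positive integer $t$, whether $\mu^*(P,n)\le t$. The following properties hold. 1. MIN-PM is an NPO problem, that is: its set of instances is recognizable in polynomial time; there is a polynomial $p$ such that every feasible solution of an instance $X$ has size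 at most $p(|X|)$ and such that it is decidable in polynomial time, given an instance $X$ and a word $y$ of size at most $p(|X|)$, whether $y$ is a feasible solution of $X$; and the measure of a feasible solution of an instance is computable in polynomial time. 2. MIN-PM$_D\equiv_T^p$ MIN-PM$_E\le_T^p$ MIN-PM$_C$, where $\le_T^p$ is polynomial-time Turing reducibility and $\equiv_T^p$ is reducibility in both directions; in particular both MIN-PM$_D$ and MIN-PM$_E$ reduce to MIN-PM$_C$. 3. MIN-PM$_D$ (the language of all $((P,n),t)$ with $\mu^*(P,n)\le t$) is in NP. -/

import Mathlib

open Polynomial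

/-! ## Machine model: oracle programs on finitely many stacks of bits -/

namespace Complexity

/-- Programs of an oracle machine whose memory consists of stacks of bits, numbered by `ℕ` (a
program mentions only finitely many of them). All instructions except `query` act on the top cell
of one stack, so this is a multi-tape Turing machine up to constant factors in the running time. -/
inductive Prog : Type
  | skip : Prog
  /-- Push the bit `b` on the stack `r`. -/
  | push (r : ℕ) (b : Bool) : Prog
  /-- Remove the top bit of the stack `r` (no effect if it is empty). -/
  | pop (r : ℕ) : Prog
  /-- Replace the content of the stack `r` by the answer of the oracle to it. -/
  | query (r : ℕ) : Prog
  /-- Execute `p`, then `q`. -/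
  | seq (p q : Prog) : Prog
  /-- Inspect the top of the stack `r`: execute `p` if it is `true`, `q` if it is `false`,
  and `e` if the stack is empty. -/
  | branch (r : ℕ) (p q e : Prog) : Prog
  /-- Execute `p` as long as the stack `r` is nonempty when tested. -/
  | loop (r : ℕ) (p : Prog) : Prog

/-- The program contains no oracle query. -/
def Prog.OracleFree : Prog → Prop
  | .skip => True
  | .push _ _ => True
  | .pop _ => True
  | .query _ => False
  | .seq p q => p.OracleFree ∧ q.OracleFree
  | .branch _ p q e => p.OracleFree ∧ q.OracleFree ∧ e.OracleFree
  | .loop _ p => p.OracleFree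

/-- The content of all stacks (the head of a list is the top of the stack). -/
abbrev Store : Type := ℕ → List Bool

/-- `Run O p s t s'`: with oracle `O`, the program `p` started on `s` halts after exactly `t` steps
with memory `s'`. Each instruction and each test takes one step; a query takes in addition one step
for each bit of the answer. -/
inductive Run (O : List Bool → List Bool) : Prog → Store → ℕ → Store → Prop
  | skip (s : Store) : Run O .skip s 1 s
  | push (r : ℕ) (b : Bool) (s : Store) :
      Run O (.push r b) s 1 (Function.update s r (b :: s r))
  | pop (r : ℕ) (s : Store) : Run O (.pop r) s 1 (Function.update s r (s r).tail)
  | query (r : ℕ) (s : Store) :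
      Run O (.query r) s (1 + (O (s r)).length) (Function.update s r (O (s r)))
  | seq {p q : Prog} {s s' s'' : Store} {t t' : ℕ} :
      Run O p s t s' → Run O q s' t' s'' → Run O (.seq p q) s (t + t') s''
  | branch_true {r : ℕ} {p q e : Prog} {s s' : Store} {t : ℕ} :
      (s r).head? = some true → Run O p s t s' → Run O (.branch r p q e) s (1 + t) s'
  | branch_false {r : ℕ} {p q e : Prog} {s s' : Store} {t : ℕ} :
      (s r).head? = some false → Run O q s t s' → Run O (.branch r p q e) s (1 + t) s'
  | branch_empty {r : ℕ} {p q e : Prog} {s s' : Store} {t : ℕ} :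
      s r = [] → Run O e s t s' → Run O (.branch r p q e) s (1 + t) s'
  | loop_exit {r : ℕ} {p : Prog} {s : Store} :
      s r = [] → Run O (.loop r p) s 1 s
  | loop_step {r : ℕ} {p : Prog} {s s' s'' : Store} {t t' : ℕ} :
      s r ≠ [] → Run O p s t s' → Run O (.loop r p) s' t' s'' →
        Run O (.loop r p) s (1 + t + t') s''

/-- Initial memory: the input `w` on the stack `0`, all other stacks empty. -/
def initialStore (w : List Bool) : Store := fun i => if i = 0 then w else []

/-- With oracle `O`, the program `M` on input `w` halts after at most `T` steps and its output,
the final content of the stack `0`, is `r`. -/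
def Outputs (O : List Bool → List Bool) (M : Prog) (w r : List Bool) (T : ℕ) : Prop :=
  ∃ t ≤ T, ∃ s : Store, Run O M (initialStore w) t s ∧ s 0 = r

/-! ## Computational problems, polynomial time, Turing reductions, NP -/

/-- Self-delimiting encoding of a pair of bit strings. -/
def pair (u v : List Bool) : List Bool := u.flatMap (fun b => [true, b]) ++ false :: v

theorem pair_inj {u v u' v' : List Bool} (h : pair u v = pair u' v') : u = u' ∧ v = v' := by
  induction u generalizing u' with
  | nil =>
    cases u' with
    | nil => simpa [pair] using h
    | cons a l => simp [pair] at h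
  | cons a l ih =>
    cases u' with
    | nil => simp [pair] at h
    | cons a' l' =>
      have h2 : a = a' ∧ pair l v = pair l' v' := by simpa [pair] using h
      obtain ⟨h3, h4⟩ := ih h2.2
      exact ⟨by rw [h2.1, h3], h4⟩

/-- A computational problem: a set of admissible inputs and, for each of them, the set of correct
answers. (Decision problems, function problems and search problems are all of this form.) -/
structure CompProblem where
  inputs : Set (List Bool)
  answers : List Bool → Set (List Bool)

/-- The oracle `O` answers every admissible input correctly (it may answer anything elsewhere). -/
def CompProblem.SolvedBy (B : CompProblem) (O : List Bool → List Bool) : Prop :=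
  ∀ w ∈ B.inputs, O w ∈ B.answers w

/-- The problem is solvable in polynomial time, without oracle. -/
def CompProblem.PolyTimeSolvable (A : CompProblem) : Prop :=
  ∃ (M : Prog) (p : ℕ[X]), M.OracleFree ∧ ∀ w ∈ A.inputs, ∃ r ∈ A.answers w,
    Outputs (fun _ => []) M w r (p.eval w.length)

/-- Polynomial-time Turing reducibility `A ≤ B`: one oracle program and one polynomial time bound
work for all oracles that solve `B`. -/
def CompProblem.TuringReducible (A B : CompProblem) : Prop :=
  ∃ (M : Prog) (p : ℕ[X]), ∀ O : List Bool → List Bool, B.SolvedBy O →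
    ∀ w ∈ A.inputs, ∃ r ∈ A.answers w, Outputs O M w r (p.eval w.length)

/-- Polynomial-time Turing equivalence. -/
def CompProblem.TuringEquivalent (A B : CompProblem) : Prop :=
  A.TuringReducible B ∧ B.TuringReducible A

open Classical in
/-- The problem to decide, for the inputs in `I`, whether they belong to `L`. -/
noncomputable def decisionProblem (I L : Set (List Bool)) : CompProblem where
  inputs := I
  answers w := {[decide (w ∈ L)]}

/-- The class P. -/
def InP (L : Set (List Bool)) : Prop := (decisionProblem Set.univ L).PolyTimeSolvable

/-- The class NP, by certificates of polynomial length that are checked in polynomial time. -/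
def InNP (L : Set (List Bool)) : Prop :=
  ∃ (p : ℕ[X]) (R : Set (List Bool)), InP R ∧
    ∀ w, w ∈ L ↔ ∃ c : List Bool, c.length ≤ p.eval w.length ∧ pair w c ∈ R

/-! ## Optimization problems -/

/-- The optimization criterion. -/
inductive Criterion : Type
  | min
  | max

/-- The value `a` is at least as good as the value `b`. -/
def Criterion.AsGood : Criterion → ℕ → ℕ → Prop
  | .min, a, b => a ≤ b
  | .max, a, b => b ≤ a

/-- An optimization problem, with binary encodings of its instances and of the objects among which
the feasible solutions are sought. Natural numbers are encoded in binary by `Nat.bits`. -/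
structure OptProblem.{u} where
  Instance : Type u
  Solution : Type u
  encI : Instance → List Bool
  encI_injective : Function.Injective encI
  encS : Solution → List Bool
  encS_injective : Function.Injective encS
  Sol : Instance → Set Solution
  measure : Instance → Solution → ℕ
  measure_pos : ∀ x, ∀ y ∈ Sol x, 0 < measure x y
  opt : Criterion

namespace OptProblem

variable (A : OptProblem)

/-- `y` is an optimal solution of `x`. -/
def IsOptimal (x : A.Instance) (y : A.Solution) : Prop :=
  y ∈ A.Sol x ∧ ∀ z ∈ A.Sol x, A.opt.AsGood (A.measure x y) (A.measure x z)

/-- `m` is the measure of the optimal solutions of `x` (and `x` has optimal solutions). -/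
def IsOptValue (x : A.Instance) (m : ℕ) : Prop :=
  ∃ y, A.IsOptimal x y ∧ A.measure x y = m

/-- The predicate of the decision problem: the optimal value of `x` is at least as good as `t`. -/
def Accepts (x : A.Instance) (t : ℕ) : Prop := ∃ m, A.IsOptValue x m ∧ A.opt.AsGood m t

/-- The underlying language. -/
def language : Set (List Bool) := {w | ∃ x t, A.Accepts x t ∧ w = pair (A.encI x) t.bits}

/-- Constructive problem: given `x`, compute an optimal solution and its measure. -/
def constructive : CompProblem where
  inputs := {w | ∃ x, (∃ y, A.IsOptimal x y) ∧ w = A.encI x}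
  answers w := {r | ∃ x y, w = A.encI x ∧ A.IsOptimal x y ∧
    r = pair (A.encS y) (A.measure x y).bits}

/-- Evaluation problem: given `x`, compute the optimal value. -/
def evaluation : CompProblem where
  inputs := {w | ∃ x, (∃ y, A.IsOptimal x y) ∧ w = A.encI x}
  answers w := {r | ∃ x m, w = A.encI x ∧ A.IsOptValue x m ∧ r = m.bits}

/-- Decision problem: given `x` and a positive integer `t`, decide whether the optimal value of `x`
is at least as good as `t`. -/
noncomputable def decision : CompProblem :=
  decisionProblem {w | ∃ (x : A.Instance) (t : ℕ), 0 < t ∧ w = pair (A.encI x) t.bits} A.language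

/-- The class NPO. -/
structure IsNPO : Prop where
  /-- The set of instances is recognizable in polynomial time. -/
  instances : InP (Set.range A.encI)
  /-- For some polynomial `p`, the feasible solutions of `x` have size at most `p |x|`, and it is
  decidable in polynomial time whether a string of size at most `p |x|` is one of them. -/
  solutions : ∃ p : ℕ[X],
    (∀ x, ∀ y ∈ A.Sol x, (A.encS y).length ≤ p.eval (A.encI x).length) ∧
    (decisionProblem
      {w | ∃ x v, v.length ≤ p.eval (A.encI x).length ∧ w = pair (A.encI x) v}
      {w | ∃ x, ∃ y ∈ A.Sol x, w = pair (A.encI x) (A.encS y)}).PolyTimeSolvable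
  /-- The measure function is computable in polynomial time. -/
  measure_computable : CompProblem.PolyTimeSolvable
    { inputs := {w | ∃ x, ∃ y ∈ A.Sol x, w = pair (A.encI x) (A.encS y)}
      answers := fun w => {r | ∃ x, ∃ y ∈ A.Sol x, w = pair (A.encI x) (A.encS y) ∧
        r = (A.measure x y).bits} }

end OptProblem

end Complexity

/-! ## The minimum-weight polynomial multiple problem -/

namespace MinPM

open Complexity

variable {F : Type*} [Field F] [Fintype F]

/-- Binary codes for the elements of `F`, all of length `⌈log₂ |F|⌉`. -/
abbrev Code (F : Type*) [Fintype F] : Type _ := F ↪ (Fin (Nat.clog 2 (Fintype.card F)) → Bool)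

/-- A polynomial is encoded by the codes of its coefficients, from the constant coefficient up to
the leading one: `(deg P + 1) * ⌈log₂ |F|⌉` bits. -/
def encPoly (e : Code F) (P : F[X]) : List Bool :=
  (List.range (P.natDegree + 1)).flatMap fun i => List.ofFn (e (P.coeff i))

theorem flatMap_range_inj {α : Type*} {b : ℕ} {f g : ℕ → List α} (hf : ∀ i, (f i).length = b)
    (hg : ∀ i, (g i).length = b) (m : ℕ)
    (h : (List.range m).flatMap f = (List.range m).flatMap g) : ∀ i < m, f i = g i := by
  induction m with
  | zero => simp
  | succ m ih =>
    rw [List.range_succ, List.flatMap_append, List.flatMap_append] at h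
    have hl : ((List.range m).flatMap f).length = ((List.range m).flatMap g).length := by
      simp [List.length_flatMap, hf, hg]
    obtain ⟨h1, h2⟩ := List.append_inj h hl
    intro i hi
    rcases Nat.lt_succ_iff_lt_or_eq.mp hi with hi | rfl
    · exact ih h1 i hi
    · simpa using h2

theorem encPoly_length (e : Code F) (P : F[X]) :
    (encPoly e P).length = (P.natDegree + 1) * Nat.clog 2 (Fintype.card F) := by
  simp [encPoly, List.length_flatMap]

theorem encPoly_injective (e : Code F) : Function.Injective (encPoly e) := by
  intro P Q h
  have hb : 0 < Nat.clog 2 (Fintype.card F) :=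
    Nat.clog_pos (by norm_num) Fintype.one_lt_card
  have hd : P.natDegree = Q.natDegree := by
    have h1 := congrArg List.length h
    rw [encPoly_length, encPoly_length] at h1
    have := Nat.eq_of_mul_eq_mul_right hb h1
    omega
  unfold encPoly at h
  rw [← hd] at h
  have h2 := flatMap_range_inj (b := Nat.clog 2 (Fintype.card F)) (by simp) (by simp) _ h
  ext i
  by_cases hi : i < P.natDegree + 1
  · exact e.injective (List.ofFn_injective (h2 i hi))
  · rw [coeff_eq_zero_of_natDegree_lt (by omega), coeff_eq_zero_of_natDegree_lt (by omega)]

theorem bits_injective : Function.Injective Nat.bits := by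
  intro a b h
  have key : ∀ n : ℕ, n.bits.foldr (fun b k => Nat.bit b k) 0 = n := by
    intro n
    induction n using Nat.binaryRec' with
    | zero => simp
    | bit b n hn ih => rw [Nat.bits_append_bit n b hn, List.foldr_cons, ih]
  rw [← key a, ← key b, h]

/-- MIN-PM over the finite field `F`, where `n` is bounded by the polynomial `r` in `deg P`.
Instances are the pairs `(P, n)` with `P ≠ 0` and `deg P < n ≤ r (deg P)`; feasible solutions of
`(P, n)` are the nonzero multiples of `P` of degree less than `n`; the Hamming weight is to be
minimized. -/
def minPM (e : Code F) (r : ℕ[X]) : OptProblem where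
  Instance := {x : F[X] × ℕ //
    x.1 ≠ 0 ∧ x.1.natDegree < x.2 ∧ x.2 ≤ r.eval x.1.natDegree}
  Solution := F[X]
  encI x := pair (encPoly e x.1.1) x.1.2.bits
  encI_injective := by
    intro x y h
    obtain ⟨h1, h2⟩ := pair_inj h
    exact Subtype.ext (Prod.ext (encPoly_injective e h1) (bits_injective h2))
  encS := encPoly e
  encS_injective := encPoly_injective e
  Sol x := {K | K ≠ 0 ∧ K.natDegree < x.1.2 ∧ x.1.1 ∣ K}
  measure _ K := K.support.card
  measure_pos := by
    intro x K hK
    exact Finset.card_pos.mpr (support_nonempty.mpr hK.1)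
  opt := .min

end MinPM

/-! A feasible `K` has degree below `n ≤ r (deg P)`, and `deg P` is less than the length of the
instance because all coefficients of `P` are written out. So feasible solutions have polynomially
bounded encodings although `n` is given in binary (`MinPM.length_encPoly_le`). Over a fixed finite
field the arithmetic operations are finite tables; division with remainder, comparison of degrees
with `n` and counting of nonzero coefficients therefore take polynomial time. This gives the NPO
properties, and the same tests with `K` as certificate give membership in NP.

For the reductions, `P` itself is feasible, so the minimum exists and lies between 1 and `deg P +
1`, hence below the length of the instance (`MinPM.isOptValue_le`). A single query for the optimal
value, or for an optimal solution with its measure, decides `μ* ≤ t` by one comparison. Conversely,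
the value is found from the decision oracle by trying `t = 1, 2, ...`, which takes only linearly
many queries. Answers of the oracle are short in all cases, so receiving them is affordable.

Most of the work is to justify "polynomial time" on the stack machine. `PolyTime f` asks for an
oracle-free program that starts with the argument alone on stack 0 and ends with the value alone
there. Such programs compose, since their output has polynomial length (`PolyTime.length_enc_le`).
Pairing, case distinction and iteration (`prodMk`, `optionElim_aux`, `iterate`) then yield folds and
all list operations, and the tests become functional expressions assembled by `fun_prop`. Iteration
and folds need an explicit size bound, because repeated polynomial growth may be exponential. -/

namespace Complexity

/-! ## Execution of programs -/

/-- The store whose stacks are the entries of `l`, followed by empty stacks. -/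
def st (l : List (List Bool)) : Store := fun i => l.getD i []

theorem initialStore_eq (w : List Bool) : initialStore w = st [w] := by
  funext i
  cases i <;> simp [initialStore, st]

/-- All stacks beyond the list are empty anyway; this makes scratch stacks appear before a program
runs and vanish afterwards. -/
theorem st_append_nil (l : List (List Bool)) : st (l ++ [[]]) = st l := by
  funext i
  simp only [st, List.getD_eq_getElem?_getD]
  rcases lt_trichotomy i l.length with h | h | h
  · rw [List.getElem?_append_left h]
  · subst h; simp
  · rw [List.getElem?_eq_none (by simp; omega), List.getElem?_eq_none (by omega)]

theorem update_st {l : List (List Bool)} {i : ℕ} (h : i < l.length) (x : List Bool) :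
    Function.update (st l) i x = st (l.set i x) := by
  funext j
  by_cases hj : j = i
  · subst hj; simp [st, h]
  · simp [st, hj, Ne.symm hj]

/-- The program `p` leads from `s` to `s'` in at most `T` steps. -/
def Exec (O : List Bool → List Bool) (p : Prog) (s s' : Store) (T : ℕ) : Prop :=
  ∃ t ≤ T, Run O p s t s'

variable {O : List Bool → List Bool}

theorem Exec.mono {p : Prog} {s s' : Store} {T T' : ℕ} (h : Exec O p s s' T) (hT : T ≤ T') :
    Exec O p s s' T' := by
  obtain ⟨t, ht, hr⟩ := h
  exact ⟨t, ht.trans hT, hr⟩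

theorem Exec.seq {p q : Prog} {s s' s'' : Store} {T T' : ℕ} (h : Exec O p s s' T)
    (h' : Exec O q s' s'' T') : Exec O (.seq p q) s s'' (T + T') := by
  obtain ⟨t, ht, hr⟩ := h
  obtain ⟨t', ht', hr'⟩ := h'
  exact ⟨t + t', by omega, .seq hr hr'⟩

theorem Exec.skip (s : Store) : Exec O .skip s s 1 := ⟨1, le_rfl, .skip s⟩

theorem Exec.push (r : ℕ) (b : Bool) (s : Store) :
    Exec O (.push r b) s (Function.update s r (b :: s r)) 1 := ⟨1, le_rfl, .push r b s⟩

theorem Exec.pop (r : ℕ) (s : Store) :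
    Exec O (.pop r) s (Function.update s r (s r).tail) 1 := ⟨1, le_rfl, .pop r s⟩

theorem Exec.query (r : ℕ) (s : Store) :
    Exec O (.query r) s (Function.update s r (O (s r))) (1 + (O (s r)).length) :=
  ⟨_, le_rfl, .query r s⟩

theorem Exec.push_st {l : List (List Bool)} {r : ℕ} (hr : r < l.length) (b : Bool) :
    Exec O (.push r b) (st l) (st (l.set r (b :: l[r]))) 1 := by
  have := Exec.push (O := O) r b (st l)
  rw [update_st hr] at this
  simpa [st, hr] using this

theorem Exec.pop_st {l : List (List Bool)} {r : ℕ} (hr : r < l.length) :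
    Exec O (.pop r) (st l) (st (l.set r l[r].tail)) 1 := by
  have := Exec.pop (O := O) r (st l)
  rw [update_st hr] at this
  simpa [st, hr] using this

theorem Exec.query_st {l : List (List Bool)} {r : ℕ} (hr : r < l.length) :
    Exec O (.query r) (st l) (st (l.set r (O l[r]))) (1 + (O l[r]).length) := by
  have := Exec.query (O := O) r (st l)
  rw [update_st hr] at this
  simpa [st, hr] using this

theorem Exec.branch_true {r : ℕ} {p q e : Prog} {s s' : Store} {T : ℕ} {l : List Bool}
    (hs : s r = true :: l) (h : Exec O p s s' T) : Exec O (.branch r p q e) s s' (1 + T) := by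
  obtain ⟨t, ht, hr⟩ := h
  exact ⟨1 + t, by omega, .branch_true (by simp [hs]) hr⟩

theorem Exec.branch_false {r : ℕ} {p q e : Prog} {s s' : Store} {T : ℕ} {l : List Bool}
    (hs : s r = false :: l) (h : Exec O q s s' T) : Exec O (.branch r p q e) s s' (1 + T) := by
  obtain ⟨t, ht, hr⟩ := h
  exact ⟨1 + t, by omega, .branch_false (by simp [hs]) hr⟩

theorem Exec.branch_empty {r : ℕ} {p q e : Prog} {s s' : Store} {T : ℕ}
    (hs : s r = []) (h : Exec O e s s' T) : Exec O (.branch r p q e) s s' (1 + T) := by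
  obtain ⟨t, ht, hr⟩ := h
  exact ⟨1 + t, by omega, .branch_empty hs hr⟩

theorem Exec.loop_exit {r : ℕ} {p : Prog} {s : Store} (hs : s r = []) :
    Exec O (.loop r p) s s 1 := ⟨1, le_rfl, .loop_exit hs⟩

theorem Exec.loop_step {r : ℕ} {p : Prog} {s s' s'' : Store} {T T' : ℕ} (hs : s r ≠ [])
    (h : Exec O p s s' T) (h' : Exec O (.loop r p) s' s'' T') :
    Exec O (.loop r p) s s'' (1 + T + T') := by
  obtain ⟨t, ht, hr⟩ := h
  obtain ⟨t', ht', hr'⟩ := h'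
  exact ⟨1 + t + t', by omega, .loop_step hs hr hr'⟩

/-- Without oracle queries, a stack grows by at most one bit per step. -/
theorem Run.length_le {p : Prog} {s s' : Store} {t : ℕ} (h : Run O p s t s')
    (hp : p.OracleFree) (i : ℕ) : (s' i).length ≤ (s i).length + t := by
  induction h with
  | skip s => omega
  | push r b s =>
    by_cases hi : i = r
    · subst hi; simp
    · simp [hi]
  | pop r s =>
    by_cases hi : i = r
    · subst hi; simp; omega
    · simp [hi]
  | query r s => exact hp.elim
  | seq _ _ ih ih' => have := ih hp.1; have := ih' hp.2; omega
  | branch_true _ _ ih => have := ih hp.1; omega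
  | branch_false _ _ ih => have := ih hp.2.1; omega
  | branch_empty _ _ ih => have := ih hp.2.2; omega
  | loop_exit _ => omega
  | loop_step _ _ _ ih ih' => have := ih hp; have := ih' hp; omega

/-- Renumber all stacks by `r ↦ r + 1`. -/
def Prog.shift : Prog → Prog
  | .skip => .skip
  | .push r b => .push (r + 1) b
  | .pop r => .pop (r + 1)
  | .query r => .query (r + 1)
  | .seq p q => .seq p.shift q.shift
  | .branch r p q e => .branch (r + 1) p.shift q.shift e.shift
  | .loop r p => .loop (r + 1) p.shift

theorem Prog.OracleFree.shift {p : Prog} (hp : p.OracleFree) : p.shift.OracleFree := by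
  induction p with
  | skip => trivial
  | push => trivial
  | pop => trivial
  | query => exact hp.elim
  | seq p q ih ih' => exact ⟨ih hp.1, ih' hp.2⟩
  | branch r p q e ih ih' ih'' => exact ⟨ih hp.1, ih' hp.2.1, ih'' hp.2.2⟩
  | loop r p ih => exact ih hp

/-- The store with first stack `x`, followed by the stacks of `s`. -/
def Store.cons (x : List Bool) (s : Store) : Store
  | 0 => x
  | i + 1 => s i

theorem Store.update_cons (x : List Bool) (s : Store) (r : ℕ) (y : List Bool) :
    Function.update (Store.cons x s) (r + 1) y = Store.cons x (Function.update s r y) := by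
  funext i
  cases i with
  | zero => simp [Store.cons]
  | succ i =>
    by_cases h : i = r
    · subst h; simp [Store.cons]
    · simp [Store.cons, h]

theorem st_cons (x : List Bool) (l : List (List Bool)) : st (x :: l) = Store.cons x (st l) := by
  funext i
  cases i <;> simp [st, Store.cons]

/-- A shifted program never touches stack 0, so a value can be kept there while a subroutine written
for stack 0 runs on stack 1. -/
theorem Run.shift {p : Prog} {s s' : Store} {t : ℕ} (h : Run O p s t s') (x : List Bool) :
    Run O p.shift (Store.cons x s) t (Store.cons x s') := by
  induction h with
  | skip s => exact .skip _
  | push r b s => rw [← Store.update_cons]; exact .push (r + 1) b (Store.cons x s)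
  | pop r s => rw [← Store.update_cons]; exact .pop (r + 1) (Store.cons x s)
  | query r s => rw [← Store.update_cons]; exact .query (r + 1) (Store.cons x s)
  | seq _ _ ih ih' => exact .seq ih ih'
  | branch_true hs _ ih => exact .branch_true hs ih
  | branch_false hs _ ih => exact .branch_false hs ih
  | branch_empty hs _ ih => exact .branch_empty hs ih
  | loop_exit hs => exact .loop_exit hs
  | loop_step hs _ _ ih ih' => exact .loop_step hs ih ih'

theorem Exec.shift {p : Prog} {l l' : List (List Bool)} {T : ℕ} (h : Exec O p (st l) (st l') T)
    (x : List Bool) : Exec O p.shift (st (x :: l)) (st (x :: l')) T := by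
  obtain ⟨t, ht, hr⟩ := h
  rw [st_cons, st_cons]
  exact ⟨t, ht, hr.shift x⟩

/-! ## Basic programs -/

/-- Move the top bit of the stack `i` to the stack `j`. -/
def Prog.moveBit (i j : ℕ) : Prog :=
  .seq (.branch i (.push j true) (.push j false) .skip) (.pop i)

theorem exec_moveBit {l : List (List Bool)} {i j : ℕ} (hi : i < l.length) (hj : j < l.length)
    (hij : i ≠ j) {b : Bool} {u : List Bool} (h : l[i] = b :: u) :
    Exec O (.moveBit i j) (st l) (st ((l.set j (b :: l[j])).set i u)) 3 := by
  have h1 : st l i = b :: u := by simp [st, hi, h]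
  have h2 := Exec.pop_st (O := O) (l := l.set j (b :: l[j])) (r := i) (by simpa using hi)
  simp only [List.getElem_set_ne hij.symm, h, List.tail_cons] at h2
  have h3 : Exec O (.branch i (.push j true) (.push j false) .skip) (st l)
      (st (l.set j (b :: l[j]))) 2 := by
    cases b
    · exact .branch_false h1 (.push_st hj false)
    · exact .branch_true h1 (.push_st hj true)
  exact h3.seq h2

/-- Move the content of the stack `i` to the stack `j`, in reversed order. -/
def Prog.move (i j : ℕ) : Prog := .loop i (.moveBit i j)

theorem exec_move {i j : ℕ} (hij : i ≠ j) (u : List Bool) (l : List (List Bool))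
    (hi : i < l.length) (hj : j < l.length) (h : l[i] = u) :
    Exec O (.move i j) (st l) (st ((l.set j (u.reverse ++ l[j])).set i [])) (4 * u.length + 1) := by
  induction u generalizing l with
  | nil =>
    have : (l.set j ([].reverse ++ l[j])).set i [] = l := by
      simp only [List.reverse_nil, List.nil_append, List.set_getElem_self]
      rw [← h, List.set_getElem_self]
    rw [this]
    exact .loop_exit (by simp [st, hi, h])
  | cons b u ih =>
    have h1 := exec_moveBit (O := O) hi hj hij h
    have h2 := ih ((l.set j (b :: l[j])).set i u) (by simpa using hi) (by simpa using hj)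
      (by simp)
    have h3 := Exec.loop_step (r := i) (by simp [st, hi, h]) h1 h2
    refine Exec.mono (T := 1 + 3 + (4 * u.length + 1)) ?_ (by simp; omega)
    simpa [Prog.move, List.getElem_set_ne hij, List.set_comm _ _ hij] using h3

/-- Empty the stack `i`. -/
def Prog.clear (i : ℕ) : Prog := .loop i (.pop i)

theorem exec_clear {i : ℕ} (u : List Bool) (l : List (List Bool)) (hi : i < l.length)
    (h : l[i] = u) : Exec O (.clear i) (st l) (st (l.set i [])) (2 * u.length + 1) := by
  induction u generalizing l with
  | nil =>
    have : l.set i [] = l := by simp [← h]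
    rw [this]
    exact .loop_exit (by simp [st, hi, h])
  | cons b u ih =>
    have h1 := Exec.pop_st (O := O) hi
    have h2 := ih (l.set i l[i].tail) (by simpa using hi) (by simp [h])
    have h3 := Exec.loop_step (r := i) (by simp [st, hi, h]) h1 h2
    refine Exec.mono (T := 1 + 1 + (2 * u.length + 1)) ?_ (by simp; omega)
    simpa [Prog.clear] using h3

theorem st_pad1 (a : List Bool) : st [a] = st [a, [], []] := by
  rw [← st_append_nil [a], ← st_append_nil]; rfl

theorem st_pad2 (a b : List Bool) : st [a, b] = st [a, b, []] := by
  rw [← st_append_nil [a, b]]; rfl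

/-- From `w` on the stack `0`, make a copy on the stack `1`. -/
def Prog.dup : Prog :=
  .seq (.move 0 2) (.loop 2 (.seq (.branch 2 (.push 1 true) (.push 1 false) .skip) (.moveBit 2 0)))

theorem exec_dup_loop (a b u : List Bool) :
    Exec O (.loop 2 (.seq (.branch 2 (.push 1 true) (.push 1 false) .skip) (.moveBit 2 0)))
      (st [a, b, u]) (st [u.reverse ++ a, u.reverse ++ b]) (6 * u.length + 1) := by
  induction u generalizing a b with
  | nil => simpa [st_pad2 a b] using Exec.loop_exit (O := O) (r := 2) (s := st [a, b, []]) rfl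
  | cons c u ih =>
    have h3 : Exec O (.branch 2 (.push 1 true) (.push 1 false) .skip) (st [a, b, c :: u])
        (st [a, c :: b, c :: u]) 2 := by
      cases c
      · exact .branch_false rfl (.push_st (l := [a, b, false :: u]) (r := 1) (by simp) false)
      · exact .branch_true rfl (.push_st (l := [a, b, true :: u]) (r := 1) (by simp) true)
    have h4 := exec_moveBit (O := O) (l := [a, c :: b, c :: u]) (i := 2) (j := 0)
      (by simp) (by simp) (by simp) rfl
    have h5 := Exec.loop_step (r := 2) (s := st [a, b, c :: u]) (by simp [st]) (h3.seq h4)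
      (ih (c :: a) (c :: b))
    refine Exec.mono (by simpa using h5) (by simp; omega)

theorem exec_dup (w : List Bool) : Exec O .dup (st [w]) (st [w, w]) (10 * w.length + 2) := by
  rw [st_pad1]
  have h1 := exec_move (O := O) (i := 0) (j := 2) (by simp) w [w, [], []] (by simp) (by simp) rfl
  have h2 := exec_dup_loop (O := O) [] [] w.reverse
  simp only [List.set_cons_zero, List.set_cons_succ, List.getElem_cons_zero,
    List.getElem_cons_succ, List.append_nil, List.reverse_reverse] at h1 h2
  refine Exec.mono (h1.seq h2) (by simp; omega)

/-- Exchange the stacks `0` and `1`. -/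
def Prog.swap : Prog :=
  .seq (.seq (.move 0 2) (.move 1 3)) (.seq (.move 3 0) (.move 2 1))

theorem exec_swap (u v : List Bool) :
    Exec O .swap (st [u, v]) (st [v, u]) (8 * u.length + 8 * v.length + 4) := by
  have e : ∀ a b : List Bool, st [a, b] = st [a, b, [], []] := fun a b => by
    rw [← st_append_nil [a, b], ← st_append_nil]; rfl
  rw [e, e]
  have h1 := exec_move (O := O) (i := 0) (j := 2) (by simp) u [u, v, [], []] (by simp) (by simp) rfl
  have h2 := exec_move (O := O) (i := 1) (j := 3) (by simp) v [[], v, u.reverse, []]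
    (by simp) (by simp) rfl
  have h3 := exec_move (O := O) (i := 3) (j := 0) (by simp) v.reverse
    [[], [], u.reverse, v.reverse] (by simp) (by simp) rfl
  have h4 := exec_move (O := O) (i := 2) (j := 1) (by simp) u.reverse
    [v, [], u.reverse, []] (by simp) (by simp) rfl
  simp only [List.set_cons_zero, List.set_cons_succ, List.getElem_cons_zero,
    List.getElem_cons_succ, List.append_nil, List.reverse_reverse] at h1 h2 h3 h4
  refine Exec.mono ((h1.seq h2).seq (h3.seq h4)) (by simp; omega)

/-- From `v` and `u` on the stacks `0` and `1`, make `pair u v` on the stack `0`. -/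
def Prog.pack : Prog :=
  .seq (.move 1 2) (.seq (.push 0 false) (.loop 2 (.seq (.moveBit 2 0) (.push 0 true))))

theorem exec_pack_loop (a u : List Bool) :
    Exec O (.loop 2 (.seq (.moveBit 2 0) (.push 0 true))) (st [a, [], u])
      (st [u.reverse.flatMap (fun b => [true, b]) ++ a]) (5 * u.length + 1) := by
  induction u generalizing a with
  | nil => simpa [st_pad1 a] using Exec.loop_exit (O := O) (r := 2) (s := st [a, [], []]) rfl
  | cons c u ih =>
    have h3 := exec_moveBit (O := O) (l := [a, [], c :: u]) (i := 2) (j := 0)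
      (by simp) (by simp) (by simp) rfl
    have h4 := Exec.push_st (O := O) (l := [c :: a, [], u]) (r := 0) (by simp) true
    have h5 := Exec.loop_step (r := 2) (by simp [st]) (h3.seq h4) (ih (true :: c :: a))
    refine Exec.mono (by simpa using h5) (by simp; omega)

theorem exec_pack (u v : List Bool) :
    Exec O .pack (st [v, u]) (st [pair u v]) (9 * u.length + 3) := by
  rw [st_pad2]
  have h1 := exec_move (O := O) (i := 1) (j := 2) (by simp) u [v, u, []] (by simp) (by simp) rfl
  have h2 := Exec.push_st (O := O) (l := [v, [], u.reverse]) (r := 0) (by simp) false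
  have h3 := exec_pack_loop (O := O) (false :: v) u.reverse
  simp only [List.set_cons_zero, List.set_cons_succ, List.getElem_cons_zero,
    List.getElem_cons_succ, List.append_nil, List.reverse_reverse] at h1 h2 h3
  refine Exec.mono (h1.seq (h2.seq h3)) (by simp; omega)

/-- Left inverse of `pair`, defined on all words. -/
def unpair : List Bool → List Bool × List Bool
  | true :: b :: l => (b :: (unpair l).1, (unpair l).2)
  | [true] => ([], [])
  | false :: l => ([], l)
  | [] => ([], [])

@[simp] theorem unpair_pair (u v : List Bool) : unpair (pair u v) = (u, v) := by
  induction u with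
  | nil => simp [pair, unpair]
  | cons a l ih =>
    have h : pair (a :: l) v = true :: a :: pair l v := by simp [pair]
    rw [h, unpair, ih]

theorem length_unpair (w : List Bool) :
    (unpair w).1.length + (unpair w).2.length ≤ w.length := by
  induction w using unpair.induct <;> simp [unpair]
  omega

/-- One step of the recursion for `unpair`. -/
def Prog.splitStep : Prog :=
  .branch 0 (.seq (.pop 0) (.branch 0 (.moveBit 0 1) (.moveBit 0 1) .skip))
    (.seq (.pop 0) (.move 0 2)) .skip

/-- From `w` on the stack `0`, put the components of `unpair w` on the stacks `0` and `1`. -/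
def Prog.split : Prog :=
  .seq (.loop 0 .splitStep)
  (.seq (.move 1 0) (.move 2 1))

theorem exec_split_loop (w a : List Bool) :
    Exec O (.loop 0 .splitStep) (st [w, a, []])
      (st [[], (unpair w).1.reverse ++ a, (unpair w).2.reverse]) (7 * w.length + 1) := by
  induction w using unpair.induct generalizing a with
  | case1 b l ih =>
    have h1 := Exec.pop_st (O := O) (l := [true :: b :: l, a, []]) (r := 0) (by simp)
    have h2 := exec_moveBit (O := O) (l := [b :: l, a, []]) (i := 0) (j := 1)
      (by simp) (by simp) (by simp) rfl
    have h3 : Exec O (.branch 0 (.moveBit 0 1) (.moveBit 0 1) .skip) (st [b :: l, a, []])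
        (st [l, b :: a, []]) 4 := by
      cases b
      · exact .branch_false rfl h2
      · exact .branch_true rfl h2
    have h4 := Exec.loop_step (r := 0) (p := .splitStep) (s := st [true :: b :: l, a, []])
      (by simp [st])
      (Exec.branch_true rfl (h1.seq (by simpa using h3))) (ih (b :: a))
    refine Exec.mono (by simpa [unpair] using h4) (by simp; omega)
  | case2 =>
    have h1 := Exec.pop_st (O := O) (l := [[true], a, []]) (r := 0) (by simp)
    have h3 : Exec O (.branch 0 (.moveBit 0 1) (.moveBit 0 1) .skip) (st [[], a, []])
        (st [[], a, []]) 2 := .branch_empty rfl (.skip _)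
    have h4 := Exec.loop_step (r := 0) (p := .splitStep) (s := st [[true], a, []]) (by simp [st])
      (Exec.branch_true (r := 0) (l := []) rfl (h1.seq (by simpa using h3))) (Exec.loop_exit rfl)
    refine Exec.mono (by simpa [unpair] using h4) (by simp)
  | case3 l =>
    have h1 := Exec.pop_st (O := O) (l := [false :: l, a, []]) (r := 0) (by simp)
    have h2 := exec_move (O := O) (i := 0) (j := 2) (by simp) l [l, a, []] (by simp) (by simp) rfl
    have h4 := Exec.loop_step (r := 0) (p := .splitStep) (s := st [false :: l, a, []]) (by simp [st])
      (Exec.branch_false (r := 0) (l := l) rfl (h1.seq (by simpa using h2)))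
      (Exec.loop_exit rfl)
    refine Exec.mono (by simpa [unpair] using h4) (by simp; omega)
  | case4 => exact .loop_exit rfl

theorem exec_split (w : List Bool) :
    Exec O .split (st [w]) (st [(unpair w).1, (unpair w).2]) (11 * w.length + 3) := by
  rw [st_pad1, st_pad2]
  have h1 := exec_split_loop (O := O) w []
  have h2 := exec_move (O := O) (i := 1) (j := 0) (by simp) (unpair w).1.reverse
    [[], (unpair w).1.reverse, (unpair w).2.reverse] (by simp) (by simp) rfl
  have h3 := exec_move (O := O) (i := 2) (j := 1) (by simp) (unpair w).2.reverse
    [(unpair w).1, [], (unpair w).2.reverse] (by simp) (by simp) rfl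
  simp only [List.set_cons_zero, List.set_cons_succ, List.getElem_cons_zero,
    List.getElem_cons_succ, List.append_nil, List.reverse_reverse] at h1 h2 h3
  have := length_unpair w
  refine Exec.mono (h1.seq (h2.seq h3)) (by simp; omega)

end Complexity

namespace Complexity

/-! ## Polynomial-time functions between encoded types -/

/-- Coefficients in `ℕ` are nonnegative; a time bound may thus be evaluated at any upper bound for
the input length. -/
theorem eval_mono (p : ℕ[X]) {m n : ℕ} (h : m ≤ n) : p.eval m ≤ p.eval n := by
  induction p using Polynomial.induction_on' with
  | add p q hp hq => simp only [eval_add]; omega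
  | monomial k a => simp only [eval_monomial]; gcongr

/-- A binary encoding. -/
class Enc (α : Type*) where
  enc : α → List Bool

open Enc

/-- Words, encoded by themselves. -/
structure Word where
  bits : List Bool

instance : Enc Word := ⟨Word.bits⟩

instance : Enc Bool := ⟨fun b => [b]⟩

/-- Natural numbers are encoded in unary. -/
instance : Enc ℕ := ⟨fun n => List.replicate n true⟩

instance {α β : Type*} [Enc α] [Enc β] : Enc (α × β) := ⟨fun x => pair (enc x.1) (enc x.2)⟩

/-- With this choice a unary number has the same code as its optional predecessor, and a list the
same code as its optional pair of head and tail; destructing them costs nothing. -/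
instance {α : Type*} [Enc α] : Enc (Option α) := ⟨fun x => x.elim [] fun a => true :: enc a⟩

/-- Encoding of lists by nested pairs. -/
def encList {α : Type*} [Enc α] : List α → List Bool
  | [] => []
  | a :: l => true :: pair (enc a) (encList l)

instance {α : Type*} [Enc α] : Enc (List α) := ⟨encList⟩

theorem length_pair (u v : List Bool) : (pair u v).length = 2 * u.length + v.length + 1 := by
  simp [pair, List.length_flatMap]; omega

section Enc

variable {α β : Type*} [Enc α] [Enc β]

theorem enc_word (w : Word) : enc w = w.bits := rfl

theorem enc_bool (b : Bool) : enc b = [b] := rfl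

theorem enc_nat (n : ℕ) : enc n = List.replicate n true := rfl

theorem length_enc_nat (n : ℕ) : (enc n).length = n := by simp [enc_nat]

theorem enc_prod (x : α × β) : enc x = pair (enc x.1) (enc x.2) := rfl

theorem length_enc_prod (x : α × β) :
    (enc x).length = 2 * (enc x.1).length + (enc x.2).length + 1 := by
  rw [enc_prod, length_pair]

theorem enc_some (a : α) : enc (some a) = true :: enc a := rfl

theorem enc_nil : enc ([] : List α) = [] := rfl

theorem enc_cons (a : α) (l : List α) : enc (a :: l) = true :: pair (enc a) (enc l) := rfl

theorem length_enc_cons (a : α) (l : List α) :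
    (enc (a :: l)).length = 2 * (enc a).length + (enc l).length + 2 := by
  simp only [enc_cons, List.length_cons, length_pair]

theorem length_enc_list (l : List α) :
    (enc l).length = (l.map fun a => 2 * (enc a).length + 2).sum := by
  induction l with
  | nil => rfl
  | cons a l ih => rw [length_enc_cons, ih]; simp; omega

theorem length_le_length_enc (l : List α) : 2 * l.length ≤ (enc l).length := by
  induction l with
  | nil => simp
  | cons a l ih => rw [length_enc_cons]; simp; omega

theorem length_enc_le_of_mem {l : List α} {a : α} (h : a ∈ l) :
    2 * (enc a).length + 2 ≤ (enc l).length := by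
  rw [length_enc_list]
  exact List.single_le_sum (by simp) _ (List.mem_map.2 ⟨a, h, rfl⟩)

end Enc

/-- Polynomial-time computable functions. -/
@[fun_prop] def PolyTime {α β : Type*} [Enc α] [Enc β] (f : α → β) : Prop :=
  ∃ (M : Prog) (p : ℕ[X]), M.OracleFree ∧ ∀ O a,
    Exec O M (st [enc a]) (st [enc (f a)]) (p.eval (enc a).length)

namespace PolyTime

variable {α β γ σ : Type*} [Enc α] [Enc β] [Enc γ] [Enc σ]

/-- An oracle-free program adds at most one bit per step to a stack, so the time bound also bounds
the growth of the output. -/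
theorem length_enc_le {f : α → β} (hf : PolyTime f) :
    ∃ p : ℕ[X], ∀ a, (enc (f a)).length ≤ p.eval (enc a).length := by
  obtain ⟨M, p, hM, h⟩ := hf
  refine ⟨X + p, fun a => ?_⟩
  obtain ⟨t, ht, hr⟩ := h (fun _ => []) a
  have := hr.length_le hM 0
  simp [st] at this ⊢
  omega

theorem of_enc_eq {f : α → β} (h : ∀ a, enc (f a) = enc a) : PolyTime f :=
  ⟨.skip, 1, trivial, fun O a => by rw [h]; simpa using Exec.skip _⟩

@[fun_prop] theorem id : PolyTime (fun a : α => a) := of_enc_eq fun _ => rfl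

@[fun_prop] theorem comp {g : β → γ} {f : α → β} (hg : PolyTime g) (hf : PolyTime f) :
    PolyTime (fun a => g (f a)) := by
  obtain ⟨q, hq⟩ := hf.length_enc_le
  obtain ⟨M, p, hM, h⟩ := hf
  obtain ⟨M', p', hM', h'⟩ := hg
  refine ⟨.seq M M', p + p'.comp q, ⟨hM, hM'⟩, fun O a => ((h O a).seq (h' O (f a))).mono ?_⟩
  simp only [eval_add, eval_comp]
  exact Nat.add_le_add_left (eval_mono p' (hq a)) _

theorem exec_pushes (u v : List Bool) : ∃ M : Prog, M.OracleFree ∧ ∀ O,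
    Exec O M (st [v]) (st [u ++ v]) (u.length + 1) := by
  induction u with
  | nil => exact ⟨.skip, trivial, fun O => Exec.mono (Exec.skip _) (by simp)⟩
  | cons b u ih =>
    obtain ⟨M, hM, h⟩ := ih
    refine ⟨.seq M (.push 0 b), ⟨hM, trivial⟩, fun O => ?_⟩
    exact (h O).seq (Exec.push_st (l := [u ++ v]) (r := 0) (by simp) b)

@[fun_prop] theorem const (b : β) : PolyTime (fun _ : α => b) := by
  obtain ⟨M, hM, h⟩ := exec_pushes (enc b) []
  refine ⟨.seq (.clear 0) M, 2 * X + 1 + C ((enc b).length + 1), ⟨trivial, hM⟩, fun O a => ?_⟩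
  have h1 := exec_clear (O := O) (i := 0) (enc a) [enc a] (by simp) rfl
  have h2 := h O
  rw [List.append_nil] at h2
  exact (h1.seq h2).mono (by simp)

-- The input is duplicated; `g` is computed on stack 1 while the copy waits on stack 0, then the
-- stacks are exchanged and `f` is computed on the copy.
@[fun_prop] theorem prodMk {f : α → β} {g : α → γ} (hf : PolyTime f) (hg : PolyTime g) :
    PolyTime (fun a => (f a, g a)) := by
  obtain ⟨r, hr⟩ := hf.length_enc_le
  obtain ⟨q, hq⟩ := hg.length_enc_le
  obtain ⟨M, p, hM, h⟩ := hf
  obtain ⟨M', p', hM', h'⟩ := hg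
  refine ⟨.seq .dup (.seq M'.shift (.seq .swap (.seq M.shift .pack))),
    (10 * X + 2) + (p' + ((8 * X + 8 * q + 4) + (p + (9 * r + 3)))),
    ⟨by simp [Prog.dup, Prog.OracleFree, Prog.move, Prog.moveBit], hM'.shift,
      by simp [Prog.swap, Prog.OracleFree, Prog.move, Prog.moveBit], hM.shift,
      by simp [Prog.pack, Prog.OracleFree, Prog.move, Prog.moveBit]⟩, fun O a => ?_⟩
  refine ((exec_dup _).seq (((h' O a).shift _).seq
    ((exec_swap _ _).seq (((h O a).shift _).seq (exec_pack _ _))))).mono ?_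
  have := hr a
  have := hq a
  simp
  omega

/-- The components of a word under `unpair`. -/
theorem unpairWord : PolyTime (fun w : Word => (Word.mk (unpair w.bits).1)) ∧
    PolyTime (fun w : Word => (Word.mk (unpair w.bits).2)) := by
  have hS : Prog.split.OracleFree := by
    simp [Prog.split, Prog.splitStep, Prog.OracleFree, Prog.move, Prog.moveBit]
  constructor
  · refine ⟨.seq .split (.clear 1), (11 * X + 3) + (2 * X + 1), ⟨hS, trivial⟩, fun O a => ?_⟩
    have h1 := exec_clear (O := O) (i := 1) _ [(unpair a.bits).1, (unpair a.bits).2] (by simp) rfl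
    have h2 := st_append_nil [(unpair a.bits).1]
    simp only [List.set_cons_succ, List.set_cons_zero] at h1
    simp only [List.cons_append, List.nil_append] at h2
    rw [h2] at h1
    refine ((exec_split _).seq h1).mono ?_
    have := length_unpair a.bits
    simp [enc_word]
    omega
  · refine ⟨.seq .split (.seq .swap (.clear 1)), (11 * X + 3) + ((8 * X + 4) + (2 * X + 1)),
      ⟨hS, by simp [Prog.swap, Prog.OracleFree, Prog.move, Prog.moveBit], trivial⟩, fun O a => ?_⟩
    have h1 := exec_clear (O := O) (i := 1) _ [(unpair a.bits).2, (unpair a.bits).1] (by simp) rfl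
    have h2 := st_append_nil [(unpair a.bits).2]
    simp only [List.set_cons_succ, List.set_cons_zero] at h1
    simp only [List.cons_append, List.nil_append] at h2
    rw [h2] at h1
    refine ((exec_split _).seq ((exec_swap _ _).seq h1)).mono ?_
    have := length_unpair a.bits
    simp [enc_word]
    omega

/-- The encoding as a function. -/
@[fun_prop] theorem word_enc : PolyTime (fun a : α => Word.mk (enc a)) := of_enc_eq fun _ => rfl

/-- Programs see only codes, so a function on raw words serves any typed function that acts in the
same way on the codes. -/
theorem of_word {f : Word → β} (hf : PolyTime f) {g : α → γ}
    (h : ∀ a, enc (g a) = enc (f ⟨enc a⟩)) : PolyTime g := by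
  obtain ⟨M, p, hM, hr⟩ := hf
  exact ⟨M, p, hM, fun O a => by rw [h]; exact hr O ⟨enc a⟩⟩

@[fun_prop] theorem fst : PolyTime (fun x : α × β => x.1) :=
  of_word unpairWord.1 fun x => by
    change enc x.1 = (unpair (pair (enc x.1) (enc x.2))).1
    rw [unpair_pair]

@[fun_prop] theorem snd : PolyTime (fun x : α × β => x.2) :=
  of_word unpairWord.2 fun x => by
    change enc x.2 = (unpair (pair (enc x.1) (enc x.2))).2
    rw [unpair_pair]

@[fun_prop] theorem fst' {f : γ → α × β} (hf : PolyTime f) : PolyTime (fun c => (f c).1) :=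
  fst.comp hf

@[fun_prop] theorem snd' {f : γ → α × β} (hf : PolyTime f) : PolyTime (fun c => (f c).2) :=
  snd.comp hf

/-- The first bit of the code of the pair tells the cases apart. Removing it leaves the code of `c`
in the case `none`; removing two bits leaves the code of `(a, c)` in the case `some a`. -/
theorem optionElim_aux {z : γ → β} {s : α × γ → β} (hz : PolyTime z) (hs : PolyTime s) :
    PolyTime (fun x : Option α × γ => x.1.elim (z x.2) fun a => s (a, x.2)) := by
  obtain ⟨M, p, hM, h⟩ := hz
  obtain ⟨M', p', hM', h'⟩ := hs
  refine ⟨.branch 0 (.seq (.pop 0) (.seq (.pop 0) M')) (.seq (.pop 0) M) .skip,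
    3 + p + p', ⟨⟨trivial, trivial, hM'⟩, ⟨trivial, hM⟩, trivial⟩, fun O x => ?_⟩
  obtain ⟨o, c⟩ := x
  cases o with
  | none =>
    have e : enc ((none : Option α), c) = false :: enc c := rfl
    rw [e]
    have h1 := Exec.pop_st (O := O) (l := [false :: enc c]) (r := 0) (by simp)
    refine Exec.mono (Exec.branch_false rfl (h1.seq (h O c))) ?_
    have := eval_mono p (Nat.le_succ (enc c).length)
    simp at this ⊢
    omega
  | some a =>
    have e : enc (some a, c) = true :: true :: enc (a, c) := rfl
    rw [e]
    have h1 := Exec.pop_st (O := O) (l := [true :: true :: enc (a, c)]) (r := 0) (by simp)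
    have h2 := Exec.pop_st (O := O) (l := [true :: enc (a, c)]) (r := 0) (by simp)
    refine Exec.mono (Exec.branch_true rfl (h1.seq (h2.seq (h' O (a, c))))) ?_
    have := eval_mono p' (show (enc (a, c)).length ≤ (enc (a, c)).length + 1 + 1 by omega)
    simp at this ⊢
    omega

theorem optionElim {o : γ → Option α} {z : γ → β} {s : α × γ → β} (ho : PolyTime o)
    (hz : PolyTime z) (hs : PolyTime s) :
    PolyTime (fun c => (o c).elim (z c) fun a => s (a, c)) :=
  (optionElim_aux hz hs).comp (ho.prodMk id)

theorem boolCond_aux {z s : γ → β} (hz : PolyTime z) (hs : PolyTime s) :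
    PolyTime (fun x : Bool × γ => bif x.1 then s x.2 else z x.2) := by
  obtain ⟨M, p, hM, h⟩ := hz
  obtain ⟨M', p', hM', h'⟩ := hs
  refine ⟨.seq (.pop 0) (.branch 0 (.seq (.pop 0) (.seq (.pop 0) M'))
    (.seq (.pop 0) (.seq (.pop 0) M)) .skip),
    4 + p + p', ⟨trivial, ⟨trivial, trivial, hM'⟩, ⟨trivial, trivial, hM⟩, trivial⟩,
    fun O x => ?_⟩
  obtain ⟨b, c⟩ := x
  have e : enc (b, c) = true :: b :: false :: enc c := rfl
  rw [e]
  have h0 := Exec.pop_st (O := O) (l := [true :: b :: false :: enc c]) (r := 0) (by simp)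
  have h1 := Exec.pop_st (O := O) (l := [b :: false :: enc c]) (r := 0) (by simp)
  have h2 := Exec.pop_st (O := O) (l := [false :: enc c]) (r := 0) (by simp)
  have e1 := eval_mono p (show (enc c).length ≤ (enc c).length + 1 + 1 + 1 by omega)
  have e2 := eval_mono p' (show (enc c).length ≤ (enc c).length + 1 + 1 + 1 by omega)
  cases b
  · refine Exec.mono (h0.seq (Exec.branch_false rfl (h1.seq (h2.seq (h O c))))) ?_
    simp at e1 e2 ⊢
    omega
  · refine Exec.mono (h0.seq (Exec.branch_true rfl (h1.seq (h2.seq (h' O c))))) ?_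
    simp at e1 e2 ⊢
    omega

@[fun_prop] theorem boolCond {b : γ → Bool} {z s : γ → β} (hb : PolyTime b) (hs : PolyTime s)
    (hz : PolyTime z) : PolyTime (fun c => bif b c then s c else z c) :=
  (boolCond_aux hz hs).comp (hb.prodMk id)

/-- Iteration, provided that the intermediate results have polynomial size. -/
theorem iterate {step : σ → σ} {cnt : γ → ℕ} {init : γ → σ} (hs : PolyTime step)
    (hc : PolyTime cnt) (hi : PolyTime init) (B : ℕ[X])
    (hB : ∀ c, ∀ k ≤ cnt c, (enc (step^[k] (init c))).length ≤ B.eval (enc c).length) :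
    PolyTime (fun c => step^[cnt c] (init c)) := by
  obtain ⟨M, p, hM, h⟩ := hs
  have hg := hc.prodMk hi
  obtain ⟨q, hq⟩ := hg.length_enc_le
  obtain ⟨M', p', hM', h'⟩ := hg
  -- The unary counter on stack 0 drives the loop while the shifted step program transforms the
  -- state on stack 1. The two final moves reverse the result twice and so restore its order.
  refine ⟨.seq M' (.seq .split
    (.seq (.loop 0 (.seq (.pop 0) M.shift)) (.seq (.move 1 2) (.move 2 0)))),
    p' + ((11 * q + 3) + ((q * (2 + p.comp B) + 1) + (8 * B + 2))),
    ⟨hM', by simp [Prog.split, Prog.splitStep, Prog.OracleFree, Prog.move, Prog.moveBit],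
      ⟨trivial, hM.shift⟩, by simp [Prog.OracleFree, Prog.move, Prog.moveBit]⟩, fun O c => ?_⟩
  have key : ∀ N n : ℕ, ∀ y : σ, (∀ k ≤ n, (enc (step^[k] y)).length ≤ N) →
      Exec O (.loop 0 (.seq (.pop 0) M.shift)) (st [enc n, enc y])
        (st [[], enc (step^[n] y)]) (n * (2 + p.eval N) + 1) := by
    intro N n
    induction n with
    | zero => intro y _; exact Exec.mono (Exec.loop_exit rfl) (by simp)
    | succ n ih =>
      intro y hy
      have e : enc (n + 1) = true :: enc n := by simp [enc_nat, List.replicate_succ]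
      rw [e]
      have h1 := Exec.pop_st (O := O) (l := [true :: enc n, enc y]) (r := 0) (by simp)
      have h2 := (h O y).shift (enc n)
      have h3 := ih (step y) fun k hk => by
        rw [← Function.iterate_succ_apply]; exact hy (k + 1) (by omega)
      rw [← Function.iterate_succ_apply] at h3
      refine Exec.mono (Exec.loop_step (by simp [st]) (h1.seq h2) h3) ?_
      have := eval_mono p (hy 0 (by omega))
      simp only [Function.iterate_zero_apply] at this
      nlinarith
  have h1 := exec_split (O := O) (enc (cnt c, init c))
  rw [enc_prod, unpair_pair, ← enc_prod] at h1
  have h2 := key _ (cnt c) (init c) (hB c)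
  have h3 := exec_move (O := O) (i := 1) (j := 2) (by simp) _
    [[], enc (step^[cnt c] (init c)), []] (by simp) (by simp) rfl
  have h4 := exec_move (O := O) (i := 2) (j := 0) (by simp)
    (enc (step^[cnt c] (init c))).reverse
    [[], [], (enc (step^[cnt c] (init c))).reverse] (by simp) (by simp) rfl
  simp only [List.set_cons_zero, List.set_cons_succ, List.getElem_cons_zero,
    List.getElem_cons_succ, List.append_nil, List.reverse_reverse] at h3 h4
  rw [← st_pad2] at h3
  rw [← st_pad1] at h4
  refine ((h' O c).seq (h1.seq (h2.seq (h3.seq h4)))).mono ?_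
  have e1 := hB c (cnt c) le_rfl
  have e0 := hq c
  have e2 : cnt c ≤ q.eval (enc c).length := by
    rw [length_enc_prod, length_enc_nat] at e0; dsimp only at e0; omega
  have e3 := Nat.mul_le_mul_right (2 + p.eval (B.eval (enc c).length)) e2
  simp only [eval_comp, eval_add, eval_mul, eval_one, eval_ofNat, List.length_reverse]
  omega

/-- Iteration with a parameter. -/
theorem iterate_param {step : γ × σ → σ} {cnt : γ → ℕ} {init : γ → σ} (hs : PolyTime step)
    (hc : PolyTime cnt) (hi : PolyTime init) (B : ℕ[X])
    (hB : ∀ c, ∀ k ≤ cnt c,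
      (enc ((fun s => step (c, s))^[k] (init c))).length ≤ B.eval (enc c).length) :
    PolyTime (fun c => (fun s => step (c, s))^[cnt c] (init c)) := by
  -- The parameter travels unchanged as part of the state.
  have key : ∀ c, ∀ k, (fun y : γ × σ => (y.1, step y))^[k] (c, init c) =
      (c, (fun s => step (c, s))^[k] (init c)) := by
    intro c k
    induction k with
    | zero => rfl
    | succ k ih => rw [Function.iterate_succ_apply', ih, Function.iterate_succ_apply']
  have h := iterate (step := fun y : γ × σ => (y.1, step y)) (fst.prodMk hs) hc (id.prodMk hi)
    (2 * X + B + 1) fun c k hk => by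
      rw [key, length_enc_prod]
      have := hB c k hk
      simp
      omega
  simpa [key] using h.snd'

theorem length_enc : PolyTime (fun a : α => (enc a).length) := by
  have key : ∀ (O : List Bool → List Bool) (u : List Bool) (n : ℕ),
      Exec O (.loop 0 (.seq (.pop 0) (.push 1 true))) (st [u, List.replicate n true])
        (st [[], List.replicate (u.length + n) true]) (3 * u.length + 1) := by
    intro O u
    induction u with
    | nil => intro n; simpa using Exec.loop_exit rfl
    | cons b u ih =>
      intro n
      have h1 := Exec.pop_st (O := O) (l := [b :: u, List.replicate n true]) (r := 0) (by simp)
      have h2 := Exec.push_st (O := O) (l := [u, List.replicate n true]) (r := 1) (by simp) true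
      have h3 := ih (n + 1)
      rw [List.replicate_succ] at h3
      have h4 := Exec.loop_step (r := 0) (by simp [st]) (h1.seq h2) h3
      have e : u.length + (n + 1) = (b :: u).length + n := by simp; omega
      rw [e] at h4
      exact h4.mono (by simp; omega)
  refine ⟨.seq (.loop 0 (.seq (.pop 0) (.push 1 true))) (.move 1 0), (3 * X + 1) + (4 * X + 1),
    by simp [Prog.OracleFree, Prog.move, Prog.moveBit], fun O a => ?_⟩
  have h1 := key O (enc a) 0
  have h2 := exec_move (O := O) (i := 1) (j := 0) (by simp) _
    [[], List.replicate ((enc a).length + 0) true] (by simp) (by simp) rfl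
  have e1 := st_append_nil [enc a]
  have e2 := st_append_nil [enc (enc a).length]
  simp only [List.cons_append, List.nil_append] at e1 e2
  rw [← e1, ← e2]
  simp only [List.set_cons_zero, List.set_cons_succ, List.getElem_cons_zero, List.reverse_replicate,
    List.getElem_cons_succ, List.append_nil, List.length_replicate, Nat.add_zero] at h1 h2
  exact (h1.seq h2).mono (by simp)

/-! ### Booleans, natural numbers, options, lists -/

@[fun_prop] theorem some {f : γ → α} (hf : PolyTime f) : PolyTime (fun c => Option.some (f c)) := by
  obtain ⟨M, p, hM, h⟩ := hf
  exact ⟨.seq M (.push 0 true), p + 1, ⟨hM, trivial⟩, fun O c =>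
    ((h O c).seq (Exec.push_st (l := [enc (f c)]) (r := 0) (by simp) true)).mono (by simp)⟩

/-- The predecessor, `none` for `0`. -/
theorem ppred : PolyTime (fun n : ℕ => n.ppred) := of_enc_eq fun n => by
  cases n
  · rfl
  · simp [enc_some, enc_nat, List.replicate_succ]

@[fun_prop] theorem succ {f : γ → ℕ} (hf : PolyTime f) : PolyTime (fun c => f c + 1) :=
  have : PolyTime (fun n : ℕ => n + 1) :=
    of_word (f := fun w => Option.some w) (by fun_prop) fun n => by
      simp [enc_some, enc_nat, enc_word, List.replicate_succ]
  this.comp hf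

/-- Both sides have literally the same code. -/
theorem uncons_aux :
    PolyTime (fun l : List α => match l with
      | [] => none
      | a :: l => Option.some (a, l)) :=
  of_enc_eq fun l => by cases l <;> rfl

theorem listCases {l : γ → List α} {z : γ → β} {s : (α × List α) × γ → β} (hl : PolyTime l)
    (hz : PolyTime z) (hs : PolyTime s) :
    PolyTime (fun c => match l c with
      | [] => z c
      | a :: t => s ((a, t), c)) := by
  have := optionElim (uncons_aux.comp hl) hz hs
  convert this using 2 with c
  cases l c <;> rfl

@[fun_prop] theorem cons {a : γ → α} {l : γ → List α} (ha : PolyTime a) (hl : PolyTime l) :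
    PolyTime (fun c => a c :: l c) :=
  have : PolyTime (fun x : α × List α => x.1 :: x.2) :=
    of_word (f := fun w => Option.some w) (by fun_prop) fun _ => rfl
  this.comp (ha.prodMk hl)

@[fun_prop] theorem not {b : γ → Bool} (hb : PolyTime b) : PolyTime (fun c => !b c) := by
  have : PolyTime (fun c => bif b c then false else true) := by fun_prop
  convert this using 2 with c
  cases b c <;> rfl

@[fun_prop] theorem and {a b : γ → Bool} (ha : PolyTime a) (hb : PolyTime b) :
    PolyTime (fun c => a c && b c) := by
  have : PolyTime (fun c => bif a c then b c else false) := by fun_prop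
  convert this using 2 with c
  cases a c <;> rfl

@[fun_prop] theorem or {a b : γ → Bool} (ha : PolyTime a) (hb : PolyTime b) :
    PolyTime (fun c => a c || b c) := by
  have : PolyTime (fun c => bif a c then true else b c) := by fun_prop
  convert this using 2 with c
  cases a c <;> rfl

/-- Folds, provided that each step adds a polynomial amount to the size. -/
theorem foldl {L : γ → List α} {init : γ → β} {f : γ × β × α → β} (hL : PolyTime L)
    (hi : PolyTime init) (hf : PolyTime f) (B : ℕ[X])
    (hB : ∀ c b, ∀ a ∈ L c, (enc (f (c, b, a))).length ≤ (enc b).length + B.eval (enc c).length) :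
    PolyTime (fun c => (L c).foldl (fun b a => f (c, b, a)) (init c)) := by
  -- The state consists of the unread part of the list and the accumulator. On an empty list the
  -- step is idle, so too many iterations do no harm.
  let step : γ × (List α × β) → List α × β := fun x => match x.2.1 with
    | [] => ([], x.2.2)
    | a :: l => (l, f (x.1, x.2.2, a))
  have hstep : PolyTime step :=
    listCases (l := fun x : γ × (List α × β) => x.2.1) (z := fun x => ([], x.2.2))
      (s := fun y : (α × List α) × γ × (List α × β) => (y.1.2, f (y.2.1, y.2.2.2, y.1.1)))
      (by fun_prop) (by fun_prop) (by fun_prop)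
  have hfold : ∀ c n (l : List α) b, l.length ≤ n → ((fun s => step (c, s))^[n] (l, b)) =
      ([], l.foldl (fun b a => f (c, b, a)) b) := by
    intro c n
    induction n with
    | zero => intro l b h; simp at h; simp [h]
    | succ n ih =>
      intro l b h
      rw [Function.iterate_succ_apply]
      cases l with
      | nil => exact ih _ _ (by simp)
      | cons a l => exact ih _ _ (by simpa using h)
  obtain ⟨q, hq⟩ := hL.length_enc_le
  obtain ⟨q', hq'⟩ := hi.length_enc_le
  -- Each unread element reserves `B` bits for the growth it may cause; the inclusion is kept
  -- because `hB` covers only elements of `L c`.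
  have hsize : ∀ c k (l : List α) b, l ⊆ L c →
      (enc ((fun s => step (c, s))^[k] (l, b))).length ≤
        2 * (enc l).length + (enc b).length + 1 + l.length * B.eval (enc c).length := by
    intro c k
    induction k with
    | zero => intro l b h; simp [length_enc_prod]
    | succ k ih =>
      intro l b h
      rw [Function.iterate_succ_apply]
      cases l with
      | nil => exact ih [] b h
      | cons a l =>
        refine (ih l _ fun x hx => h (by simp [hx])).trans ?_
        have := hB c b a (h (by simp))
        rw [length_enc_cons, List.length_cons, add_mul, one_mul]
        dsimp only
        omega
  -- The length of the code, already known to be computable, serves as a sufficient number of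
  -- iterations; the length of the list is itself obtained from a fold later.
  have h := iterate_param (cnt := fun c => (enc (L c)).length) (init := fun c => (L c, init c))
    hstep (length_enc.comp hL) (hL.prodMk hi) (2 * q + q' + 1 + q * B) fun c k _ => by
      refine (hsize c k _ _ (List.Subset.refl _)).trans ?_
      have e1 := hq c
      have e2 := hq' c
      have e3 := length_le_length_enc (L c)
      have e4 := Nat.mul_le_mul_right (B.eval (enc c).length)
        (show (L c).length ≤ q.eval (enc c).length by omega)
      simp only [eval_add, eval_mul, eval_one, eval_ofNat]
      omega
  have h2 := h.snd'
  convert h2 using 2 with c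
  rw [hfold c _ _ _ (by have := length_le_length_enc (L c); omega)]

end PolyTime
end Complexity

/-! ### List operations in polynomial time -/

namespace Complexity
open Enc
namespace PolyTime

variable {α β γ σ : Type*} [Enc α] [Enc β] [Enc γ] [Enc σ]

@[fun_prop] theorem headD {l : γ → List α} {d : γ → α} (hl : PolyTime l) (hd : PolyTime d) :
    PolyTime (fun c => (l c).headD (d c)) := by
  have := listCases (z := d) (s := fun y : (α × List α) × γ => y.1.1) hl hd (by fun_prop)
  convert this using 2 with c
  cases l c <;> rfl

@[fun_prop] theorem tail {l : γ → List α} (hl : PolyTime l) :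
    PolyTime (fun c => (l c).tail) := by
  have := listCases (z := fun _ => []) (s := fun y : (α × List α) × γ => y.1.2) hl (by fun_prop)
    (by fun_prop)
  convert this using 2 with c
  cases l c <;> rfl

@[fun_prop] theorem isEmpty {l : γ → List α} (hl : PolyTime l) :
    PolyTime (fun c => (l c).isEmpty) := by
  have := listCases (z := fun _ => true) (s := fun _ : (α × List α) × γ => false) hl (by fun_prop)
    (by fun_prop)
  convert this using 2 with c
  cases l c <;> rfl

@[fun_prop] theorem pred {n : γ → ℕ} (hn : PolyTime n) : PolyTime (fun c => n c - 1) := by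
  have := optionElim (ppred.comp hn) (z := fun _ => 0) (s := fun y : ℕ × γ => y.1)
    (by fun_prop) (by fun_prop)
  convert this using 2 with c
  cases n c <;> simp

@[fun_prop] theorem reverse {l : γ → List α} (hl : PolyTime l) :
    PolyTime (fun c => (l c).reverse) := by
  obtain ⟨q, hq⟩ := hl.length_enc_le
  have := foldl (init := fun _ => []) (f := fun y : γ × List α × α => y.2.2 :: y.2.1) hl
    (by fun_prop) (by fun_prop) q fun c b a ha => by
      have := hq c
      have := length_enc_le_of_mem ha
      rw [length_enc_cons]
      dsimp only
      omega
  convert this using 2 with c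
  rw [List.foldl_eq_foldr_reverse]
  exact (List.foldr_cons_nil).symm

theorem foldr {L : γ → List α} {init : γ → β} {f : γ × β × α → β} (hL : PolyTime L)
    (hi : PolyTime init) (hf : PolyTime f) (B : ℕ[X])
    (hB : ∀ c b, ∀ a ∈ L c, (enc (f (c, b, a))).length ≤ (enc b).length + B.eval (enc c).length) :
    PolyTime (fun c => (L c).foldr (fun a b => f (c, b, a)) (init c)) := by
  have := foldl hL.reverse hi hf B fun c b a ha => hB c b a (by simpa using ha)
  simpa using this

theorem length_enc_le_of_mem' {L : γ → List α} {f : γ × α → β} (hL : PolyTime L)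
    (hf : PolyTime f) :
    ∃ B : ℕ[X], ∀ c, ∀ a ∈ L c, (enc (f (c, a))).length ≤ B.eval (enc c).length := by
  obtain ⟨q, hq⟩ := hL.length_enc_le
  obtain ⟨q', hq'⟩ := hf.length_enc_le
  refine ⟨q'.comp (2 * X + q + 1), fun c a ha => (hq' (c, a)).trans ?_⟩
  rw [eval_comp]
  apply eval_mono
  rw [length_enc_prod]
  have := hq c
  have := length_enc_le_of_mem ha
  simp
  omega

theorem map {L : γ → List α} {f : γ × α → β} (hL : PolyTime L) (hf : PolyTime f) :
    PolyTime (fun c => (L c).map fun a => f (c, a)) := by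
  obtain ⟨q, hq⟩ := length_enc_le_of_mem' hL hf
  have := foldr (init := fun _ => []) (f := fun y : γ × List β × α => f (y.1, y.2.2) :: y.2.1) hL
    (by fun_prop) (by fun_prop) (2 * q + 2) fun c b a ha => by
      have := hq c a ha
      rw [length_enc_cons]
      simp
      omega
  convert this using 2 with c
  rw [List.map_eq_foldr]

@[fun_prop] theorem append {l m : γ → List α} (hl : PolyTime l) (hm : PolyTime m) :
    PolyTime (fun c => l c ++ m c) := by
  obtain ⟨q, hq⟩ := hl.length_enc_le
  have := foldr (f := fun y : γ × List α × α => y.2.2 :: y.2.1) hl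
    hm (by fun_prop) q fun c b a ha => by
      have := hq c
      have := length_enc_le_of_mem ha
      rw [length_enc_cons]
      dsimp only
      omega
  simpa using this

theorem flatMap {L : γ → List α} {f : γ × α → List β} (hL : PolyTime L) (hf : PolyTime f) :
    PolyTime (fun c => (L c).flatMap fun a => f (c, a)) := by
  obtain ⟨q, hq⟩ := length_enc_le_of_mem' hL hf
  have := foldr (init := fun _ => []) (f := fun y : γ × List β × α => f (y.1, y.2.2) ++ y.2.1) hL
    (by fun_prop) (by fun_prop) q fun c b a ha => by
      have := hq c a ha
      have e : ∀ l m : List β, (enc (l ++ m)).length = (enc l).length + (enc m).length := by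
        intro l m
        simp [length_enc_list]
      rw [e]
      dsimp only
      omega
  convert this using 2 with c
  induction L c with
  | nil => rfl
  | cons a l ih => rw [List.flatMap_cons, ih, List.foldr_cons]

@[fun_prop] theorem length {l : γ → List α} (hl : PolyTime l) :
    PolyTime (fun c => (l c).length) := by
  have := foldr (init := fun _ => 0) (f := fun y : γ × ℕ × α => y.2.1 + 1) hl
    (by fun_prop) (by fun_prop) 1 fun c b a ha => by simp [length_enc_nat]
  convert this using 2 with c
  simp

theorem all {L : γ → List α} {f : γ × α → Bool} (hL : PolyTime L) (hf : PolyTime f) :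
    PolyTime (fun c => (L c).all fun a => f (c, a)) := by
  have := foldr (init := fun _ => true) (f := fun y : γ × Bool × α => f (y.1, y.2.2) && y.2.1) hL
    (by fun_prop) (by fun_prop) 1 fun c b a ha => by simp [enc_bool]
  convert this using 2 with c
  induction L c with
  | nil => rfl
  | cons a l ih => rw [List.all_cons, ih, List.foldr_cons]

theorem any {L : γ → List α} {f : γ × α → Bool} (hL : PolyTime L) (hf : PolyTime f) :
    PolyTime (fun c => (L c).any fun a => f (c, a)) := by
  have := (all hL hf.not).not
  convert this using 2 with c
  simp [List.not_all_eq_any_not]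

theorem countP {L : γ → List α} {f : γ × α → Bool} (hL : PolyTime L) (hf : PolyTime f) :
    PolyTime (fun c => (L c).countP fun a => f (c, a)) := by
  have := foldr (init := fun _ => 0)
    (f := fun y : γ × ℕ × α => bif f (y.1, y.2.2) then y.2.1 + 1 else y.2.1) hL
    (by fun_prop) (by fun_prop) 1 fun c b a ha => by
      cases h : f (c, a) <;> simp [length_enc_nat]
  convert this using 2 with c
  induction L c with
  | nil => rfl
  | cons a l ih => cases h : f (c, a) <;> simp [ih, h]

@[fun_prop] theorem zip {l : γ → List α} {m : γ → List β} (hl : PolyTime l) (hm : PolyTime m) :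
    PolyTime (fun c => (l c).zip (m c)) := by
  let f : γ × (List β × List (α × β)) × α → List β × List (α × β) := fun y =>
    match y.2.1.1 with
    | [] => ([], y.2.1.2)
    | b :: t => (t, (y.2.2, b) :: y.2.1.2)
  have hf : PolyTime f := listCases (l := fun y : γ × (List β × List (α × β)) × α => y.2.1.1)
    (z := fun y => ([], y.2.1.2))
    (s := fun y : (β × List β) × γ × (List β × List (α × β)) × α =>
      (y.1.2, (y.2.2.2, y.1.1) :: y.2.2.1.2)) (by fun_prop) (by fun_prop) (by fun_prop)
  obtain ⟨q, hq⟩ := hl.length_enc_le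
  -- Removing `b` from the unread list pays for its copy in the output, so only the size of `a`
  -- enters the growth bound.
  have h := foldl (init := fun c => (m c, ([] : List (α × β)))) hl (by fun_prop) hf (2 * q + 4)
    fun c s a ha => by
      obtain ⟨m, acc⟩ := s
      have e1 := hq c
      have e2 := length_enc_le_of_mem ha
      cases m with
      | nil => simp [f]
      | cons b t =>
        simp only [f, length_enc_prod, length_enc_cons, eval_add, eval_mul, eval_ofNat]
        omega
  have key : ∀ c (l : List α) (m : List β) acc,
      (l.foldl (fun b a => f (c, b, a)) (m, acc)).2 = (l.zip m).reverse ++ acc := by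
    intro c l
    induction l with
    | nil => intro m acc; simp
    | cons a l ih =>
      intro m acc
      cases m with
      | nil =>
        rw [List.foldl_cons]
        exact (ih [] acc).trans (by simp)
      | cons b t =>
        rw [List.foldl_cons]
        exact (ih t ((a, b) :: acc)).trans (by simp)
  have h2 := h.snd'.reverse
  simpa [key] using h2

@[fun_prop] theorem decide_eq_bool {a b : γ → Bool} (ha : PolyTime a) (hb : PolyTime b) :
    PolyTime (fun c => decide (a c = b c)) := by
  have : PolyTime (fun c => bif a c then b c else !b c) := by fun_prop
  convert this using 2 with c
  cases a c <;> cases b c <;> rfl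

@[fun_prop] theorem decide_eq_bits {l m : γ → List Bool} (hl : PolyTime l) (hm : PolyTime m) :
    PolyTime (fun c => decide (l c = m c)) := by
  let f : γ × (List Bool × Bool) × Bool → List Bool × Bool := fun y =>
    match y.2.1.1 with
    | [] => ([], false)
    | b :: t => (t, y.2.1.2 && decide (y.2.2 = b))
  have hf' := listCases (l := fun y : γ × (List Bool × Bool) × Bool => y.2.1.1)
    (z := fun y => ([], false))
    (s := fun y : (Bool × List Bool) × γ × (List Bool × Bool) × Bool =>
      (y.1.2, y.2.2.1.2 && decide (y.2.2.2 = y.1.1))) (by fun_prop) (by fun_prop) (by fun_prop)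
  have hf : PolyTime f := by
    convert hf' using 2 with y
    obtain ⟨c, ⟨m, _⟩, _⟩ := y
    cases m <;> rfl
  have h := foldl (init := fun c => (m c, true)) hl (by fun_prop) hf 0
    fun c s a ha => by
      obtain ⟨m, acc⟩ := s
      cases m with
      | nil => simp [f, length_enc_prod, enc_bool]
      | cons b t => simp [f, length_enc_prod, length_enc_cons, enc_bool]; omega
  -- Two words agree if every bit of `l` was matched and nothing of `m` is left; running out of `m`
  -- too early sets the flag to `false`.
  have key : ∀ c (l m : List Bool) ok,
      ((l.foldl (fun b a => f (c, b, a)) (m, ok)).2 &&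
        (l.foldl (fun b a => f (c, b, a)) (m, ok)).1.isEmpty) = (ok && decide (l = m)) := by
    intro c l
    induction l with
    | nil => intro m ok; cases m <;> simp
    | cons a l ih =>
      intro m ok
      cases m with
      | nil =>
        rw [List.foldl_cons]
        exact (ih [] false).trans (by simp)
      | cons b t =>
        rw [List.foldl_cons]
        exact (ih t (ok && decide (a = b))).trans (by simp [Bool.and_assoc])
  have h2 : PolyTime fun c => ((l c).foldl (fun b a => f (c, b, a)) (m c, true)).2 &&
    ((l c).foldl (fun b a => f (c, b, a)) (m c, true)).1.isEmpty := by fun_prop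
  simpa [key] using h2

/-! ### Words as lists of bits -/

/-- A `Word` is the raw stack content, whereas a `List Bool` spends four bits on each entry.
Replacing the top bit `b` by `true, true, b, false` yields the code of the optional pair, which
starts the conversion between the two. -/
theorem word_uncons : PolyTime (fun w : Word => match w.bits with
    | [] => (none : Option (Bool × Word))
    | b :: l => Option.some (b, Word.mk l)) := by
  refine ⟨.branch 0
    (.seq (.pop 0) (.seq (.push 0 false) (.seq (.push 0 true) (.seq (.push 0 true) (.push 0 true)))))
    (.seq (.pop 0) (.seq (.push 0 false) (.seq (.push 0 false) (.seq (.push 0 true)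
      (.push 0 true))))) .skip, 6, by simp [Prog.OracleFree], fun O w => ?_⟩
  obtain ⟨w⟩ := w
  have hp : ∀ (b : Bool) (l : List Bool), Exec O (.push 0 b) (st [l]) (st [b :: l]) 1 :=
    fun b l => Exec.push_st (l := [l]) (r := 0) (by simp) b
  have hq : ∀ (b : Bool) (l : List Bool), Exec O (.pop 0) (st [b :: l]) (st [l]) 1 :=
    fun b l => Exec.pop_st (l := [b :: l]) (r := 0) (by simp)
  rcases w with _ | ⟨_ | _, l⟩
  · exact (Exec.branch_empty rfl (Exec.skip _)).mono (by simp)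
  · exact (Exec.branch_false rfl ((hq _ _).seq ((hp _ _).seq ((hp _ _).seq ((hp _ _).seq
      (hp _ _)))))).mono (by simp)
  · exact (Exec.branch_true rfl ((hq _ _).seq ((hp _ _).seq ((hp _ _).seq ((hp _ _).seq
      (hp _ _)))))).mono (by simp)

@[fun_prop] theorem word_cons {b : γ → Bool} {l : γ → Word} (hb : PolyTime b) (hl : PolyTime l) :
    PolyTime (fun c => Word.mk (b c :: (l c).bits)) := by
  have : PolyTime (fun x : Bool × Word => Word.mk (x.1 :: x.2.bits)) := by
    refine ⟨.seq (.pop 0) (.branch 0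
      (.seq (.pop 0) (.seq (.pop 0) (.push 0 true)))
      (.seq (.pop 0) (.seq (.pop 0) (.push 0 false))) .skip), 5, by simp [Prog.OracleFree],
      fun O x => ?_⟩
    obtain ⟨b, w⟩ := x
    have hp : ∀ (b : Bool) (l : List Bool), Exec O (.push 0 b) (st [l]) (st [b :: l]) 1 :=
      fun b l => Exec.push_st (l := [l]) (r := 0) (by simp) b
    have hq : ∀ (b : Bool) (l : List Bool), Exec O (.pop 0) (st [b :: l]) (st [l]) 1 :=
      fun b l => Exec.pop_st (l := [b :: l]) (r := 0) (by simp)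
    have e : enc (b, w) = true :: b :: false :: w.bits := rfl
    rw [e]
    cases b
    · exact ((hq _ _).seq (Exec.branch_false rfl ((hq _ _).seq ((hq _ _).seq (hp _ _))))).mono
        (by simp)
    · exact ((hq _ _).seq (Exec.branch_true rfl ((hq _ _).seq ((hq _ _).seq (hp _ _))))).mono
        (by simp)
  exact this.comp (hb.prodMk hl)

@[fun_prop] theorem word_mk {l : γ → List Bool} (hl : PolyTime l) :
    PolyTime (fun c => Word.mk (l c)) := by
  have := foldr (init := fun _ => Word.mk [])
    (f := fun y : γ × Word × Bool => Word.mk (y.2.2 :: y.2.1.bits)) hl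
    (by fun_prop) (by fun_prop) 1 fun c b a ha => by simp [enc_word]
  convert this using 2 with c
  induction l c with
  | nil => rfl
  | cons a l ih => rw [List.foldr_cons, ← ih]

@[fun_prop] theorem word_bits {w : γ → Word} (hw : PolyTime w) :
    PolyTime (fun c => (w c).bits) := by
  suffices h : PolyTime (fun w : Word => w.bits) from h.comp hw
  let step : Word × List Bool → Word × List Bool := fun x =>
    (match x.1.bits with
      | [] => (none : Option (Bool × Word))
      | b :: l => Option.some (b, Word.mk l)).elim x fun y => (y.2, y.1 :: x.2)
  have hs : PolyTime step := optionElim (word_uncons.comp fst) (z := fun x => x)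
    (s := fun y : (Bool × Word) × (Word × List Bool) => (y.1.2, y.1.1 :: y.2.2))
    (by fun_prop) (by fun_prop)
  have e0 : ∀ acc, step (⟨[]⟩, acc) = (⟨[]⟩, acc) := fun _ => rfl
  have e1 : ∀ b l acc, step (⟨b :: l⟩, acc) = (⟨l⟩, b :: acc) := fun _ _ _ => rfl
  have key : ∀ (l acc : List Bool), step^[l.length] (⟨l⟩, acc) = (⟨[]⟩, l.reverse ++ acc) := by
    intro l
    induction l with
    | nil => intro acc; rfl
    | cons b l ih => intro acc; rw [List.length_cons, Function.iterate_succ_apply, e1, ih]; simp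
  -- Four bits per unread bit are reserved, the price of its entry in the output list.
  have hsize : ∀ (k : ℕ) (l acc : List Bool), (enc (step^[k] (⟨l⟩, acc))).length ≤
      4 * l.length + (enc acc).length + 1 := by
    intro k
    induction k with
    | zero => intro l acc; simp [length_enc_prod, enc_word]; omega
    | succ k ih =>
      intro l acc
      rw [Function.iterate_succ_apply]
      cases l with
      | nil => rw [e0]; exact ih _ _
      | cons b l =>
        rw [e1]
        refine (ih _ _).trans ?_
        simp [length_enc_cons, enc_bool]
        omega
  have h := iterate (cnt := fun w : Word => (enc w).length) (init := fun w => (w, [])) hs length_enc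
    (by fun_prop) (4 * X + 1) fun c k _ => by
      refine (hsize k c.bits []).trans ?_
      simp [enc_nil, enc_word]
  have h2 := h.snd'.reverse
  convert h2 using 2 with w
  have := key w.bits []
  rw [List.append_nil] at this
  change w.bits = (step^[w.bits.length] (⟨w.bits⟩, [])).2.reverse
  rw [this, List.reverse_reverse]

/-- Functions given by a finite table. -/
theorem exists_table {ι : Type*} (k : ι → List Bool) (hk : Function.Injective k) (f : ι → β)
    (d : β) (S : List ι) : ∃ g : List Bool → β, PolyTime g ∧ ∀ i ∈ S, g (k i) = f i := by
  induction S with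
  | nil => exact ⟨fun _ => d, by fun_prop, by simp⟩
  | cons i S ih =>
    obtain ⟨g, hg, h⟩ := ih
    refine ⟨fun w => bif decide (w = k i) then f i else g w, by fun_prop, fun j hj => ?_⟩
    by_cases hij : j = i
    · subst hij; simp
    · simp [hk.ne hij, h j (List.mem_of_ne_of_mem hij hj)]

/-- A finite table lookup; this is where the fixed size of the field makes its arithmetic available.
-/
theorem of_finite [Finite α] (hα : Function.Injective (enc : α → List Bool)) (f : α → β) :
    PolyTime f := by
  cases nonempty_fintype α
  cases isEmpty_or_nonempty α with
  | inl h => exact of_enc_eq fun a => h.elim a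
  | inr h =>
    obtain ⟨g, hg, hgf⟩ := exists_table enc hα f (f h.some) Finset.univ.toList
    have : PolyTime (fun a : α => g (Word.mk (enc a)).bits) := hg.comp word_enc.word_bits
    convert this using 2 with a
    exact (hgf a (by simp)).symm

/-! ### Arithmetic of natural numbers in unary -/

@[fun_prop] theorem add {m n : γ → ℕ} (hm : PolyTime m) (hn : PolyTime n) :
    PolyTime (fun c => m c + n c) := by
  obtain ⟨p, hp⟩ := hm.length_enc_le
  obtain ⟨q, hq⟩ := hn.length_enc_le
  have := iterate (step := fun n : ℕ => n + 1) (by fun_prop) hm hn (p + q) fun c k hk => by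
    have := hp c
    have := hq c
    simp [length_enc_nat] at *
    omega
  convert this using 2 with c
  simp [add_comm]

@[fun_prop] theorem mul {m n : γ → ℕ} (hm : PolyTime m) (hn : PolyTime n) :
    PolyTime (fun c => m c * n c) := by
  obtain ⟨p, hp⟩ := hm.length_enc_le
  obtain ⟨q, hq⟩ := hn.length_enc_le
  have key : ∀ a k : ℕ, (fun s => a + s)^[k] 0 = k * a := by
    intro a k
    induction k with
    | zero => simp
    | succ k ih => rw [Function.iterate_succ_apply', ih]; ring
  have := iterate_param (step := fun x : γ × ℕ => n x.1 + x.2) (init := fun _ => 0)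
    (by fun_prop) hm (by fun_prop) (p * q) fun c k hk => by
    have e1 := hp c
    have e2 := hq c
    simp only [length_enc_nat, key, eval_mul] at *
    exact Nat.mul_le_mul (hk.trans e1) e2
  simpa [key] using this

/-- Sums and products of unary numbers suffice, as `r` is fixed. -/
theorem eval_nat (r : ℕ[X]) {n : γ → ℕ} (hn : PolyTime n) :
    PolyTime (fun c => r.eval (n c)) := by
  induction r using Polynomial.induction_on with
  | C a => simp only [eval_C]; fun_prop
  | add p q hp hq => simp only [eval_add]; fun_prop
  | monomial k a ih =>
    have e : (C a * X ^ (k + 1) : ℕ[X]) = C a * X ^ k * X := by ring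
    rw [e]
    simp only [eval_mul_X]
    fun_prop

end PolyTime

/-! ### Natural numbers in binary -/

/-- The number with binary digits `l`, the least significant digit first. -/
def ofBits (l : List Bool) : ℕ := l.foldr (fun b k => Nat.bit b k) 0

theorem ofBits_bits (n : ℕ) : ofBits n.bits = n := by
  induction n using Nat.binaryRec' with
  | zero => simp [ofBits]
  | bit b n hn ih => rw [Nat.bits_append_bit n b hn, ofBits, List.foldr_cons]; exact congrArg _ ih

theorem bits_ofBits {l : List Bool} (h : l.reverse.headD true = true) : (ofBits l).bits = l := by
  induction l with
  | nil => simp [ofBits]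
  | cons b l ih =>
    have e : ofBits (b :: l) = Nat.bit b (ofBits l) := rfl
    cases l with
    | nil =>
      have : b = true := by simpa using h
      subst this
      simp [ofBits]
    | cons a l =>
      have hl : (a :: l).reverse.headD true = true := by
        rw [List.reverse_cons, List.headD_eq_head?_getD, List.head?_append_of_ne_nil _ (by simp)] at h
        simpa using h
      have h1 := ih hl
      rw [e, Nat.bits_append_bit, h1]
      intro h0
      rw [h0] at h1
      simp at h1

/-- Canonical binary words are those without a leading zero digit, which stands last here; the
default `true` admits the empty word, the code of 0. -/
theorem exists_eq_bits_iff (l : List Bool) :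
    (∃ n : ℕ, l = n.bits) ↔ l.reverse.headD true = true := by
  constructor
  · rintro ⟨n, rfl⟩
    induction n using Nat.binaryRec' with
    | zero => simp
    | bit b n hn ih =>
      rw [Nat.bits_append_bit n b hn, List.reverse_cons]
      cases h : n.bits.reverse with
      | nil =>
        have : n = 0 := by
          rw [← ofBits_bits n, List.reverse_eq_nil_iff.1 h]; rfl
        simp [hn this]
      | cons a l => simpa [h] using ih
  · exact fun h => ⟨ofBits l, (bits_ofBits h).symm⟩

/-- Binary successor. -/
def incBits : List Bool → List Bool
  | [] => [true]
  | false :: l => true :: l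
  | true :: l => false :: incBits l

theorem incBits_bits (n : ℕ) : incBits n.bits = (n + 1).bits := by
  induction n using Nat.binaryRec' with
  | zero => simp [incBits]
  | bit b n hn ih =>
    rw [Nat.bits_append_bit n b hn]
    cases b with
    | false =>
      have e : Nat.bit false n + 1 = Nat.bit true n := by simp [Nat.bit]
      rw [e, Nat.bits_append_bit n true (by simp)]
      rfl
    | true =>
      have e : Nat.bit true n + 1 = Nat.bit false (n + 1) := by simp [Nat.bit]; ring
      rw [e, Nat.bits_append_bit (n + 1) false (by simp), ← ih]
      rfl

theorem length_bits_le (n : ℕ) : n.bits.length ≤ n := by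
  rw [Nat.size_eq_bits_len, Nat.size_le]
  exact Nat.lt_two_pow_self

/-- Compare numbers in binary: `a < b`, or `a = b` and `c`. -/
def leBits : Bool → List Bool → List Bool → Bool
  | c, [], v => c || v.any fun b => b
  | c, a :: u, [] => leBits (c && !a) u []
  | c, a :: u, b :: v => leBits (bif decide (a = b) then c else b) u v

/-- Digits arrive with the least significant one first, so the flag records the comparison so far
and every later pair of different digits overrides it. -/
theorem leBits_eq (c : Bool) (u v : List Bool) :
    leBits c u v = decide (ofBits u < ofBits v ∨ ofBits u = ofBits v ∧ c = true) := by
  have e : ∀ b l, ofBits (b :: l) = 2 * ofBits l + b.toNat := fun b l => Nat.bit_val b _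
  induction c, u, v using leBits.induct with
  | case1 c v =>
    rw [leBits]
    have : (v.any fun b => b) = decide (0 < ofBits v) := by
      induction v with
      | nil => rfl
      | cons b v ih => rw [List.any_cons, ih, e]; cases b <;> simp
    rw [this]
    have : ofBits [] = 0 := rfl
    rw [this]
    cases c <;> simp
    omega
  | case2 c a u ih =>
    rw [leBits, ih, e]
    have : ofBits [] = 0 := rfl
    rw [this]
    cases a <;> cases c <;> simp
  | case3 c a u b v ih =>
    rw [leBits, ih, e, e, decide_eq_decide]
    cases a <;> cases b <;> cases c <;> simp <;> omega

theorem leBits_true (u v : List Bool) : leBits true u v = decide (ofBits u ≤ ofBits v) := by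
  rw [leBits_eq]; simp [le_iff_lt_or_eq]

/-! ### Binary arithmetic in polynomial time -/

namespace PolyTime

variable {α β γ σ : Type*} [Enc α] [Enc β] [Enc γ] [Enc σ]

theorem length_enc_bits (l : List Bool) : (enc l).length = 4 * l.length := by
  induction l with
  | nil => rfl
  | cons b l ih => rw [length_enc_cons, ih, enc_bool]; simp; omega

@[fun_prop] theorem incBits {l : γ → List Bool} (hl : PolyTime l) :
    PolyTime (fun c => incBits (l c)) := by
  suffices h : PolyTime Complexity.incBits from h.comp hl
  -- The state holds the carry, initially `true`, and the reversed output; each output digit is the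
  -- exclusive or of carry and input digit.
  have h := foldl (γ := List Bool) (L := fun l => l) (init := fun _ => (true, ([] : List Bool)))
    (f := fun y => (y.2.1.1 && y.2.2, (!decide (y.2.1.1 = y.2.2)) :: y.2.1.2)) (by fun_prop)
    (by fun_prop) (by fun_prop) 4 fun c b a ha => by
      simp [length_enc_prod, enc_bool, length_enc_bits]; omega
  have h2 : PolyTime (fun l : List Bool =>
    let s := l.foldl (fun b a => (b.1 && a, (!decide (b.1 = a)) :: b.2)) (true, ([] : List Bool))
    s.2.reverse ++ bif s.1 then [true] else []) := by
    dsimp only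
    fun_prop
  convert h2 using 2 with l
  have key0 : ∀ (l acc : List Bool),
      l.foldl (fun b a => (b.1 && a, (!decide (b.1 = a)) :: b.2)) (false, acc) =
        (false, l.reverse ++ acc) := by
    intro l
    induction l with
    | nil => intro acc; simp
    | cons b l ih => intro acc; rw [List.foldl_cons]; cases b <;> simp [ih]
  have key : ∀ (l acc : List Bool),
      (let s := l.foldl (fun b a => (b.1 && a, (!decide (b.1 = a)) :: b.2)) (true, acc)
       s.2.reverse ++ bif s.1 then [true] else []) = acc.reverse ++ Complexity.incBits l := by
    intro l
    induction l with
    | nil => intro acc; simp [Complexity.incBits]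
    | cons b l ih =>
      intro acc
      cases b
      · simp [Complexity.incBits, key0]
      · have := ih (false :: acc)
        simpa [Complexity.incBits] using this
  exact (key l []).symm

@[fun_prop] theorem bits {n : γ → ℕ} (hn : PolyTime n) : PolyTime (fun c => (n c).bits) := by
  -- Unary input allows conversion to binary by counting up from the empty word.
  have key : ∀ k : ℕ, Complexity.incBits^[k] [] = k.bits := by
    intro k
    induction k with
    | zero => simp
    | succ k ih => rw [Function.iterate_succ_apply', ih, incBits_bits]
  obtain ⟨p, hp⟩ := hn.length_enc_le
  have := iterate (init := fun _ => []) (incBits id) hn (by fun_prop) (4 * p) fun c k hk => by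
    have := hp c
    have := length_bits_le k
    rw [key, length_enc_bits]
    simp [length_enc_nat] at *
    omega
  simpa [key] using this

@[fun_prop] theorem leBits {u v : γ → List Bool} (hu : PolyTime u) (hv : PolyTime v) :
    PolyTime (fun c => leBits true (u c) (v c)) := by
  let f : γ × (List Bool × Bool) × Bool → List Bool × Bool := fun y =>
    match y.2.1.1 with
    | [] => ([], y.2.1.2 && !y.2.2)
    | b :: t => (t, bif decide (y.2.2 = b) then y.2.1.2 else b)
  have hf' := listCases (l := fun y : γ × (List Bool × Bool) × Bool => y.2.1.1)
    (z := fun y => ([], y.2.1.2 && !y.2.2))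
    (s := fun y : (Bool × List Bool) × γ × (List Bool × Bool) × Bool =>
      (y.1.2, bif decide (y.2.2.2 = y.1.1) then y.2.2.1.2 else y.1.1))
    (by fun_prop) (by fun_prop) (by fun_prop)
  have hf : PolyTime f := by
    convert hf' using 2 with y
    obtain ⟨c, ⟨m, _⟩, _⟩ := y
    cases m <;> rfl
  have h := foldl (init := fun c => (v c, true)) hu (by fun_prop) hf 0
    fun c s a ha => by
      obtain ⟨m, acc⟩ := s
      cases m with
      | nil => simp [f, length_enc_prod, enc_bool]
      | cons b t => simp [f, length_enc_prod, length_enc_cons, enc_bool]; omega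
  have key : ∀ c (l m : List Bool) ok,
      ((l.foldl (fun b a => f (c, b, a)) (m, ok)).2 ||
        (l.foldl (fun b a => f (c, b, a)) (m, ok)).1.any fun b => b) =
        Complexity.leBits ok l m := by
    intro c l
    induction l with
    | nil => intro m ok; simp [Complexity.leBits]
    | cons a l ih =>
      intro m ok
      cases m with
      | nil =>
        rw [List.foldl_cons, Complexity.leBits]
        exact ih _ _
      | cons b t =>
        rw [List.foldl_cons, Complexity.leBits]
        exact ih _ _
  have h2 := h.snd'.or (any h.fst' (f := fun y => y.2) (by fun_prop))
  simpa only [key] using h2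

end PolyTime
end Complexity

/-! ### Pairing of bit lists, and splitting of lists at a fixed position -/

namespace Complexity
open Enc
namespace PolyTime

variable {α β γ σ : Type*} [Enc α] [Enc β] [Enc γ] [Enc σ]

@[fun_prop] theorem unpair_fst {l : γ → List Bool} (hl : PolyTime l) :
    PolyTime (fun c => (unpair (l c)).1) :=
  (unpairWord.1.comp hl.word_mk).word_bits

@[fun_prop] theorem unpair_snd {l : γ → List Bool} (hl : PolyTime l) :
    PolyTime (fun c => (unpair (l c)).2) :=
  (unpairWord.2.comp hl.word_mk).word_bits

@[fun_prop] theorem pair {u v : γ → List Bool} (hu : PolyTime u) (hv : PolyTime v) :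
    PolyTime (fun c => pair (u c) (v c)) :=
  (word_enc.comp (hu.word_mk.prodMk hv.word_mk)).word_bits

theorem take_drop (n : ℕ) :
    PolyTime (fun l : List α => l.take n) ∧ PolyTime (fun l : List α => l.drop n) := by
  induction n with
  | zero => simp only [List.take_zero, List.drop_zero]; exact ⟨by fun_prop, by fun_prop⟩
  | succ n ih =>
    obtain ⟨ih1, ih2⟩ := ih
    constructor
    · have := listCases (γ := List α) (l := fun l => l) (z := fun _ => [])
        (s := fun y : (α × List α) × List α => y.1.1 :: y.1.2.take n) (by fun_prop) (by fun_prop)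
        (by fun_prop)
      convert this using 2 with l
      cases l <;> rfl
    · simp only [← List.drop_tail]
      exact ih2.comp id.tail

end PolyTime
end Complexity

namespace MinPM

open Complexity Enc

variable {F : Type*} [Field F]

/-! ## Polynomials as lists of coefficients -/

/-- The polynomial with coefficients `l`, the constant coefficient first. -/
noncomputable def ofCoeffs : List F → F[X]
  | [] => 0
  | a :: l => C a + X * ofCoeffs l

theorem coeff_ofCoeffs (l : List F) (i : ℕ) : (ofCoeffs l).coeff i = l.getD i 0 := by
  induction l generalizing i with
  | nil => simp [ofCoeffs]
  | cons a l ih =>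
    cases i with
    | zero => simp [ofCoeffs]
    | succ i => simp [ofCoeffs, coeff_C_succ, ih]

/-- The coefficients of `P`, from the constant one to the leading one. -/
noncomputable def coeffList (P : F[X]) : List F := (List.range (P.natDegree + 1)).map P.coeff

theorem ofCoeffs_coeffList (P : F[X]) : ofCoeffs (coeffList P) = P := by
  ext i
  rw [coeff_ofCoeffs]
  by_cases hi : i < P.natDegree + 1
  · simp [coeffList, hi]
  · simp [coeffList, hi, coeff_eq_zero_of_natDegree_lt (show P.natDegree < i by omega)]

theorem length_coeffList (P : F[X]) : (coeffList P).length = P.natDegree + 1 := by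
  simp [coeffList]

/-- The last entry of `l`, and `0` if there is none. -/
def lastCoeff (l : List F) : F := l.reverse.headD 0

theorem lastCoeff_coeffList (P : F[X]) : lastCoeff (coeffList P) = P.leadingCoeff := by
  simp [lastCoeff, coeffList, List.range_succ]

theorem lastCoeff_append (l : List F) (a : F) : lastCoeff (l ++ [a]) = a := by
  simp [lastCoeff]

theorem exists_append_of_lastCoeff_ne_zero {l : List F} (h : lastCoeff l ≠ 0) :
    ∃ l' a, l = l' ++ [a] ∧ a ≠ 0 := by
  rcases List.eq_nil_or_concat l with rfl | ⟨l', a, rfl⟩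
  · simp [lastCoeff] at h
  · rw [List.concat_eq_append, lastCoeff_append] at h
    exact ⟨l', a, by simp, h⟩

/-- The nonzero last entry is the leading coefficient and fixes the degree, so there are no
superfluous zeros. -/
theorem coeffList_ofCoeffs {l : List F} (h : lastCoeff l ≠ 0) :
    coeffList (ofCoeffs l) = l ∧ ofCoeffs l ≠ 0 := by
  obtain ⟨l', a, rfl, ha⟩ := exists_append_of_lastCoeff_ne_zero h
  have h1 : (ofCoeffs (l' ++ [a])).coeff l'.length = a := by simp [coeff_ofCoeffs]
  have h2 : (ofCoeffs (l' ++ [a])).natDegree = l'.length := by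
    apply le_antisymm
    · rw [natDegree_le_iff_coeff_eq_zero]
      intro N hN
      rw [coeff_ofCoeffs, List.getD_eq_default]
      simp; omega
    · exact le_natDegree_of_ne_zero (by rw [h1]; exact ha)
  constructor
  · apply List.ext_getElem
    · simp [length_coeffList, h2]
    · intro i hi hi'
      simp only [coeffList, List.getElem_map, List.getElem_range, coeff_ofCoeffs]
      exact List.getD_eq_getElem _ _ hi'
  · intro h0
    rw [h0] at h1
    exact ha (by simpa using h1.symm)

theorem ofCoeffs_append (l : List F) (a : F) :
    ofCoeffs (l ++ [a]) = ofCoeffs l + C a * X ^ l.length := by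
  induction l with
  | nil => simp [ofCoeffs]
  | cons b l ih => simp only [List.cons_append, ofCoeffs, ih, List.length_cons]; ring

/-- Equal lengths are needed because `zip` would truncate the longer list. -/
theorem ofCoeffs_sub_mul (t : F) (l m : List F) (h : l.length = m.length) :
    ofCoeffs ((l.zip m).map fun x => x.1 - t * x.2) = ofCoeffs l - C t * ofCoeffs m := by
  induction l generalizing m with
  | nil =>
    have : m = [] := List.length_eq_zero_iff.1 h.symm
    simp [this, ofCoeffs]
  | cons a l ih =>
    cases m with
    | nil => simp at h
    | cons b m =>
      simp only [List.zip_cons_cons, List.map_cons, ofCoeffs, ih m (by simpa using h)]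
      simp only [C_sub, C_mul]
      ring

open Classical in
/-- Test for zero. -/
noncomputable def isZero (a : F) : Bool := decide (a = 0)

/-- From a remainder `R` modulo the polynomial with coefficients `l`, the remainder of the
polynomial with coefficients `a :: R`. -/
def remStep (l : List F) (a : F) (R : List F) : List F :=
  ((a :: R).zip l.reverse.tail.reverse).map fun x =>
    x.1 - (lastCoeff (a :: R) * (lastCoeff l)⁻¹) * x.2

/-- The remainder of the division of `k` by `l`. -/
def remainder (l k : List F) : List F :=
  k.foldr (remStep l) (l.tail.map fun _ => 0)

/-- The divisibility test. -/
noncomputable def dvdTest (l k : List F) : Bool := (remainder l k).all isZero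

/-- The list `a :: R` is as long as the divisor. Subtracting the divisor times the quotient of the
top coefficients cancels the top entry, which the truncation by `zip` discards. -/
theorem remStep_spec {l' : List F} {y : F} (hy : y ≠ 0) (a : F) {R : List F}
    (hR : R.length = l'.length) :
    (remStep (l' ++ [y]) a R).length = l'.length ∧
    ofCoeffs (l' ++ [y]) ∣ ofCoeffs (a :: R) - ofCoeffs (remStep (l' ++ [y]) a R) := by
  obtain ⟨A, x, hA⟩ : ∃ A x, a :: R = A ++ [x] := by
    rcases List.eq_nil_or_concat (a :: R) with h | ⟨A, x, h⟩
    · simp at h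
    · exact ⟨A, x, by rw [h, List.concat_eq_append]⟩
  have hl : A.length = l'.length := by
    have := congrArg List.length hA
    simp at this
    omega
  have e : remStep (l' ++ [y]) a R = (A.zip l').map fun z => z.1 - (x * y⁻¹) * z.2 := by
    rw [remStep, hA, lastCoeff_append, lastCoeff_append]
    have h1 : (l' ++ [y]).reverse.tail.reverse = l' := by simp
    rw [h1]
    congr 1
    rw [← List.append_nil l', List.zip_append hl]
    simp
  rw [e]
  refine ⟨by simp [hl], ?_⟩
  rw [ofCoeffs_sub_mul _ _ _ hl, hA, ofCoeffs_append, ofCoeffs_append, hl]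
  refine ⟨C (x * y⁻¹), ?_⟩
  have : C x = C y * C (x * y⁻¹) := by rw [← C_mul]; congr 1; field_simp
  rw [this]
  ring

/-- Horner's scheme modulo the divisor: a congruence for the tail of `k` is multiplied by `X`, and
one reduction step restores the length. -/
theorem remainder_spec {l' : List F} {y : F} (hy : y ≠ 0) (k : List F) :
    (remainder (l' ++ [y]) k).length = l'.length ∧
    ofCoeffs (l' ++ [y]) ∣ ofCoeffs k - ofCoeffs (remainder (l' ++ [y]) k) := by
  induction k with
  | nil =>
    have : ∀ m : List F, ofCoeffs (m.map fun _ => (0 : F)) = 0 := by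
      intro m
      induction m with
      | nil => rfl
      | cons a m ih => rw [List.map_cons, ofCoeffs, ih]; simp
    have h0 : remainder (l' ++ [y]) [] = (l' ++ [y]).tail.map fun _ => 0 := rfl
    rw [h0, this]
    simp [ofCoeffs]
  | cons a k ih =>
    have e : remainder (l' ++ [y]) (a :: k) = remStep (l' ++ [y]) a (remainder (l' ++ [y]) k) := rfl
    rw [e]
    obtain ⟨h1, h2⟩ := remStep_spec hy a ih.1
    refine ⟨h1, ?_⟩
    have := (ih.2.mul_left X).add h2
    convert this using 1
    simp only [ofCoeffs]
    ring

/-- The remainder has fewer entries than the divisor; if it is divisible by the divisor, it must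
vanish for reasons of degree. -/
theorem dvdTest_iff {l : List F} (h : lastCoeff l ≠ 0) (k : List F) :
    dvdTest l k = true ↔ ofCoeffs l ∣ ofCoeffs k := by
  have hd := coeffList_ofCoeffs h
  obtain ⟨l', y, rfl, hy⟩ := exists_append_of_lastCoeff_ne_zero h
  obtain ⟨h1, h2⟩ := remainder_spec hy k
  have hdeg : (ofCoeffs (l' ++ [y])).natDegree = l'.length := by
    have := congrArg List.length hd.1
    simpa [length_coeffList] using this
  set R := remainder (l' ++ [y]) k with hR
  have h3 : dvdTest (l' ++ [y]) k = true ↔ ofCoeffs R = 0 := by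
    rw [dvdTest, ← hR]
    simp only [List.all_eq_true, isZero, decide_eq_true_eq]
    constructor
    · intro h0
      ext i
      rw [coeff_ofCoeffs, List.getD_eq_getElem?_getD]
      by_cases hi : i < R.length
      · simpa [hi] using h0 _ (List.getElem_mem hi)
      · simp [hi]
    · intro h0 a ha
      obtain ⟨i, hi, rfl⟩ := List.getElem_of_mem ha
      rw [← List.getD_eq_getElem _ 0 hi, ← coeff_ofCoeffs, h0, coeff_zero]
  rw [h3]
  constructor
  · intro h0
    simpa [h0] using h2
  · intro hk
    have h4 : ofCoeffs (l' ++ [y]) ∣ ofCoeffs R := by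
      have := hk.sub h2
      simpa using this
    by_contra h0
    have h5 := natDegree_le_of_dvd h4 h0
    -- By `h5` this index is at least `R.length`, hence beyond the list.
    have h6 : (ofCoeffs R).coeff (ofCoeffs R).natDegree = 0 := by
      rw [coeff_ofCoeffs, List.getD_eq_default]
      omega
    exact h0 (leadingCoeff_eq_zero.1 h6)

/-- The number of nonzero entries. -/
noncomputable def weight (k : List F) : ℕ := k.countP fun a => !isZero a

theorem weight_coeffList (P : F[X]) : weight (coeffList P) = P.support.card := by
  classical
  have h : P.support = (Finset.range (P.natDegree + 1)).filter fun i => P.coeff i ≠ 0 := by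
    ext i
    simp only [mem_support_iff, Finset.mem_filter, Finset.mem_range]
    exact ⟨fun h => ⟨Nat.lt_succ_of_le (le_natDegree_of_ne_zero h), h⟩, fun h => h.2⟩
  rw [h, weight, coeffList, List.countP_map, Finset.card_def, Finset.filter_val, Finset.range_val,
    ← Multiset.countP_eq_card_filter, Multiset.range, Multiset.coe_countP]
  congr 1
  funext i
  simp [isZero]

/-! ## Polynomial-time operations -/

variable [Fintype F]

/-- An internal encoding independent of the given code of `F`. Only injectivity and the uniform
bound on the length matter. -/
noncomputable instance {F : Type*} [Field F] [Fintype F] : Enc F := ⟨fun a => List.replicate (Fintype.equivFin F a) true⟩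

theorem enc_injective : Function.Injective (enc : F → List Bool) := by
  intro a b h
  have := congrArg List.length h
  simp only [enc, List.length_replicate] at this
  exact (Fintype.equivFin F).injective (Fin.ext this)

theorem length_enc_le (a : F) : (enc a).length ≤ Fintype.card F := by
  simp [enc]

theorem length_enc_list_le (l : List F) :
    (enc l).length ≤ l.length * (2 * Fintype.card F + 2) := by
  induction l with
  | nil => simp [enc_nil]
  | cons a l ih =>
    rw [length_enc_cons, List.length_cons, add_mul]
    have := length_enc_le a
    omega

section

variable {γ : Type*} [Enc γ]

theorem polyTime_field_op (f : F → F → F) {a b : γ → F} (ha : PolyTime a) (hb : PolyTime b) :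
    PolyTime (fun c => f (a c) (b c)) :=
  (PolyTime.of_finite (α := F × F) (fun _ _ h =>
    Prod.ext (enc_injective (pair_inj h).1) (enc_injective (pair_inj h).2))
    (fun x => f x.1 x.2)).comp (ha.prodMk hb)

@[fun_prop] theorem polyTime_sub {a b : γ → F} (ha : PolyTime a) (hb : PolyTime b) :
    PolyTime (fun c => a c - b c) := polyTime_field_op _ ha hb

@[fun_prop] theorem polyTime_mul {a b : γ → F} (ha : PolyTime a) (hb : PolyTime b) :
    PolyTime (fun c => a c * b c) := polyTime_field_op _ ha hb

@[fun_prop] theorem polyTime_inv {a : γ → F} (ha : PolyTime a) :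
    PolyTime (fun c => (a c)⁻¹) := (PolyTime.of_finite enc_injective (fun a : F => a⁻¹)).comp ha

@[fun_prop] theorem polyTime_isZero {a : γ → F} (ha : PolyTime a) :
    PolyTime (fun c => isZero (a c)) := (PolyTime.of_finite enc_injective isZero).comp ha

@[fun_prop] theorem polyTime_lastCoeff {l : γ → List F} (hl : PolyTime l) :
    PolyTime (fun c => lastCoeff (l c)) := by unfold lastCoeff; fun_prop

theorem polyTime_remStep :
    PolyTime (fun y : (List F × List F) × List F × F => remStep y.1.1 y.2.2 y.2.1) :=
  PolyTime.map (L := fun y : (List F × List F) × List F × F =>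
      (y.2.2 :: y.2.1).zip y.1.1.reverse.tail.reverse)
    (f := fun z => z.2.1 - (lastCoeff (z.1.2.2 :: z.1.2.1) * (lastCoeff z.1.1.1)⁻¹) * z.2.2)
    (by fun_prop) (by fun_prop)

@[fun_prop] theorem polyTime_dvdTest {l k : γ → List F} (hl : PolyTime l) (hk : PolyTime k) :
    PolyTime (fun c => dvdTest (l c) (k c)) := by
  suffices h : PolyTime (fun x : List F × List F => dvdTest x.1 x.2) by
    have := hl.prodMk hk
    exact PolyTime.comp (f := fun c => (l c, k c)) h this
  have h0 : PolyTime (fun x : List F × List F => x.1.tail.map fun _ => (0 : F)) :=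
    PolyTime.map (f := fun _ => (0 : F)) (by fun_prop) (by fun_prop)
  have h1 := PolyTime.foldr (γ := List F × List F) (α := F) (β := List F) (L := fun x => x.2)
    (init := fun x => x.1.tail.map fun _ => (0 : F))
    (f := fun y => remStep y.1.1 y.2.2 y.2.1) (by fun_prop) h0 polyTime_remStep
    -- Truncation keeps every new remainder shorter than the divisor, which is part of the input
    -- `c`; its size is thus bounded whatever `R` is.
    ((2 * C (Fintype.card F) + 2) * X) fun c R a _ => by
      have e1 := length_enc_list_le (remStep c.1 a R)
      have e2 : (remStep c.1 a R).length ≤ (enc c).length := by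
        have := length_le_length_enc c.1
        simp only [remStep, List.length_map, List.length_zip, List.length_reverse,
          List.length_tail, length_enc_prod]
        omega
      have e3 := Nat.mul_le_mul_right (2 * Fintype.card F + 2) e2
      simp only [eval_mul, eval_add, eval_ofNat, eval_C, eval_X, mul_comm _ (enc c).length]
      omega
  exact PolyTime.all (f := fun x => isZero x.2) h1 (by fun_prop)

@[fun_prop] theorem polyTime_weight {k : γ → List F} (hk : PolyTime k) :
    PolyTime (fun c => weight (k c)) :=
  PolyTime.countP (f := fun x => !isZero x.2) hk (by fun_prop)

end

/-! ## Decoding -/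

/-- The code of a field element. -/
def code {F : Type*} [Fintype F] (e : Code F) (a : F) : List Bool := List.ofFn (e a)

theorem code_injective {F : Type*} [Fintype F] (e : Code F) : Function.Injective (code e) := fun _ _ h =>
  e.injective (List.ofFn_injective h)

theorem encPoly_eq (e : Code F) (P : F[X]) : encPoly e P = (coeffList P).flatMap (code e) := by
  simp [encPoly, coeffList, List.flatMap_map, code]

theorem exists_decode (e : Code F) :
    ∃ g : List Bool → F, PolyTime g ∧ ∀ a, g (code e a) = a := by
  obtain ⟨g, hg, h⟩ := PolyTime.exists_table (code e) (code_injective e) (fun a : F => a) 0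
    Finset.univ.toList
  exact ⟨g, hg, fun a => h a (by simp)⟩

/-- Left inverse of `code`. -/
noncomputable def decode (e : Code F) : List Bool → F := (exists_decode e).choose

theorem polyTime_decode (e : Code F) : PolyTime (decode e) := (exists_decode e).choose_spec.1

theorem decode_code (e : Code F) (a : F) : decode e (code e a) = a :=
  (exists_decode e).choose_spec.2 a

/-- Decode one field element of a word. -/
noncomputable def decodeStep (e : Code F) (x : List Bool × List F) : List Bool × List F :=
  bif x.1.isEmpty then x else
    (x.1.drop (Nat.clog 2 (Fintype.card F)),
      decode e (x.1.take (Nat.clog 2 (Fintype.card F))) :: x.2)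

/-- Decode a list of field elements. -/
noncomputable def decodeList (e : Code F) (w : List Bool) : List F :=
  ((decodeStep e)^[w.length] (w, [])).2.reverse

theorem polyTime_decodeStep (e : Code F) : PolyTime (decodeStep e) := by
  have h1 := polyTime_decode e
  obtain ⟨h2, h3⟩ := PolyTime.take_drop (α := Bool) (Nat.clog 2 (Fintype.card F))
  unfold decodeStep
  fun_prop

@[fun_prop] theorem polyTime_decodeList (e : Code F) {γ : Type*} [Enc γ] {w : γ → List Bool}
    (hw : PolyTime w) : PolyTime (fun c => decodeList e (w c)) := by
  suffices h : PolyTime (decodeList e) from h.comp hw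
  have hsize : ∀ (k : ℕ) (w : List Bool) (acc : List F),
      (enc ((decodeStep e)^[k] (w, acc))).length ≤
        2 * (enc w).length + (enc acc).length + 1 + k * (2 * Fintype.card F + 2) := by
    intro k
    induction k with
    | zero => intro w acc; simp [length_enc_prod]
    | succ k ih =>
      intro w acc
      rw [Function.iterate_succ_apply, add_mul]
      cases h : w.isEmpty with
      | true =>
        have : decodeStep e (w, acc) = (w, acc) := by simp [decodeStep, h]
        rw [this]
        have := ih w acc
        omega
      | false =>
        have : decodeStep e (w, acc) = (w.drop (Nat.clog 2 (Fintype.card F)),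
          decode e (w.take (Nat.clog 2 (Fintype.card F))) :: acc) := by simp [decodeStep, h]
        rw [this]
        refine (ih _ _).trans ?_
        rw [length_enc_cons, PolyTime.length_enc_bits, PolyTime.length_enc_bits]
        have := length_enc_le (decode e (w.take (Nat.clog 2 (Fintype.card F))))
        simp only [List.length_drop]
        omega
  have h := PolyTime.iterate (cnt := fun w : List Bool => w.length) (init := fun w => (w, []))
    (polyTime_decodeStep e) (by fun_prop) (by fun_prop)
    (2 * X + 1 + X * (2 * C (Fintype.card F) + 2)) fun w k hk => by
      refine (hsize k w []).trans ?_
      have := length_le_length_enc w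
      have := Nat.mul_le_mul_right (2 * Fintype.card F + 2) (show k ≤ (enc w).length by omega)
      simp only [enc_nil, List.length_nil, eval_add, eval_mul, eval_X, eval_one, eval_ofNat, eval_C]
      omega
  exact h.snd'.reverse

/-- Each code has at least one bit since a field has two elements, so the length of the word is
enough iterations; the surplus ones are idle. -/
theorem decodeList_flatMap (e : Code F) (l : List F) : decodeList e (l.flatMap (code e)) = l := by
  have hb : 0 < Nat.clog 2 (Fintype.card F) := Nat.clog_pos (by norm_num) Fintype.one_lt_card
  have hlen : ∀ a, (code e a).length = Nat.clog 2 (Fintype.card F) := fun a => by simp [code]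
  have key : ∀ (n : ℕ) (l acc : List F), l.length ≤ n →
      (decodeStep e)^[n] (l.flatMap (code e), acc) = ([], l.reverse ++ acc) := by
    intro n
    induction n with
    | zero =>
      intro l acc h
      have : l = [] := List.length_eq_zero_iff.1 (by omega)
      simp [this]
    | succ n ih =>
      intro l acc h
      rw [Function.iterate_succ_apply]
      cases l with
      | nil => exact ih [] acc (by simp)
      | cons a l =>
        have h1 : decodeStep e ((a :: l).flatMap (code e), acc) =
            (l.flatMap (code e), a :: acc) := by
          have h2 : ((a :: l).flatMap (code e)).isEmpty = false := by
            rw [List.flatMap_cons]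
            cases h3 : code e a with
            | nil => have := hlen a; rw [h3] at this; simp at this; omega
            | cons b u => rfl
          rw [decodeStep, h2]
          simp only [List.flatMap_cons, cond_false]
          rw [List.drop_left' (hlen a), List.take_left' (hlen a), decode_code]
        rw [h1, ih l _ (by simpa using h)]
        simp
  rw [decodeList, key _ l []]
  · simp
  · rw [List.length_flatMap]
    have : ∀ l : List F, l.length ≤ (l.map fun a => (code e a).length).sum := by
      intro l
      induction l with
      | nil => simp
      | cons a l ih => rw [List.map_cons, List.sum_cons, List.length_cons, hlen]; omega
    exact this l

theorem decodeList_encPoly (e : Code F) (P : F[X]) : decodeList e (encPoly e P) = coeffList P := by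
  rw [encPoly_eq, decodeList_flatMap]

end MinPM

namespace Complexity
open Enc

/-! ## From programs to complexity classes -/

theorem Exec.outputs {O : List Bool → List Bool} {M : Prog} {w r : List Bool}
    {l : List (List Bool)} {T : ℕ} (h : Exec O M (st [w]) (st (r :: l)) T) :
    Outputs O M w r T := by
  obtain ⟨t, ht, hr⟩ := h
  exact ⟨t, ht, st (r :: l), by rw [initialStore_eq]; exact hr, rfl⟩

theorem PolyTime.solvable {β : Type*} [Enc β] {f : Word → β} (hf : PolyTime f) {A : CompProblem}
    (h : ∀ w ∈ A.inputs, enc (f ⟨w⟩) ∈ A.answers w) : A.PolyTimeSolvable := by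
  obtain ⟨M, p, hM, hr⟩ := hf
  exact ⟨M, p, hM, fun w hw => ⟨_, h w hw, (hr _ ⟨w⟩).outputs⟩⟩

theorem PolyTime.decision_solvable {f : Word → Bool} (hf : PolyTime f) {I L : Set (List Bool)}
    (h : ∀ w ∈ I, f ⟨w⟩ = true ↔ w ∈ L) : (decisionProblem I L).PolyTimeSolvable :=
  hf.solvable fun w hw => by
    rw [enc_bool]
    congr 1
    rw [← Bool.decide_coe (f ⟨w⟩), decide_eq_decide]
    exact h w hw

/-- The common shape of the one-query reductions to a decision: `v` waits on stack 1 while `u` is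
replaced by the answer. The hypothesis on the answer is needed because its length is charged. -/
theorem exists_query_program {g : Word × Word → Bool} (hg : PolyTime g) (q : ℕ[X]) :
    ∃ (M : Prog) (p : ℕ[X]), ∀ (O : List Bool → List Bool) (u v : List Bool),
      (O u).length ≤ q.eval u.length →
        Exec O M (st [pair u v]) (st [[g (⟨v⟩, ⟨O u⟩)]]) (p.eval (pair u v).length) := by
  obtain ⟨M, p, -, h⟩ := hg
  refine ⟨.seq .split (.seq (.query 0) (.seq .pack M)),
    (11 * X + 3) + ((1 + q) + ((9 * X + 3) + p.comp (2 * X + q + 1))), fun O u v ho => ?_⟩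
  have h1 := exec_split (O := O) (pair u v)
  rw [unpair_pair] at h1
  have h2 := Exec.query_st (O := O) (l := [u, v]) (r := 0) (by simp)
  have h3 := exec_pack (O := O) v (O u)
  have h4 := h O (⟨v⟩, ⟨O u⟩)
  refine (h1.seq (h2.seq (h3.seq h4))).mono ?_
  have e1 : u.length ≤ (pair u v).length := by rw [length_pair]; omega
  have e2 : v.length ≤ (pair u v).length := by rw [length_pair]; omega
  have e3 := ho.trans (eval_mono q e1)
  have e4 : p.eval (enc ((⟨v⟩, ⟨O u⟩) : Word × Word)).length ≤
      p.eval (2 * (pair u v).length + q.eval (pair u v).length + 1) := by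
    apply eval_mono
    rw [length_enc_prod, enc_word, enc_word]
    dsimp only
    omega
  simp only [eval_add, eval_mul, eval_comp, eval_X, eval_one, eval_ofNat, List.getElem_cons_zero]
  omega

/-- Search for the least `t > 0` such that the oracle accepts the pair of `u` and `t`. -/
theorem exists_search_program : ∃ (M : Prog) (p : ℕ[X]), ∀ (O : List Bool → List Bool)
    (u : List Bool) (m : ℕ), 0 < m → m ≤ u.length →
      (∀ t, 0 < t → O (pair u t.bits) = [decide (m ≤ t)]) →
        Exec O M (st [u]) (st [m.bits]) (p.eval u.length) := by
  have h0 : PolyTime (fun w : Word => (w, Word.mk [true])) := by fun_prop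
  have h1 : PolyTime (fun x : Word × Word => (x.1, Word.mk (incBits x.2.bits))) := by fun_prop
  have h2 : PolyTime (fun x : Word × Word => x.2) := by fun_prop
  obtain ⟨M0, p0, -, h0⟩ := h0
  obtain ⟨M1, p1, -, h1⟩ := h1
  obtain ⟨M2, p2, -, h2⟩ := h2
  -- Stack 1 serves both as loop flag and as place for the query: the flag is removed, a copy of the
  -- pair is queried there, and a new flag is set only after the answer `false`.
  let body : Prog := .seq (.pop 1) (.seq .dup (.seq (.query 1)
    (.branch 1 (.pop 1) (.seq (.pop 1) (.seq M1 (.push 1 true))) .skip)))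
  -- The cost of one round: duplication, the increment, and a constant, for a pair of length at most
  -- `3 * |u| + 1`.
  let N : ℕ[X] := 10 * (3 * X + 1) + 20 + p1.comp (3 * X + 1)
  refine ⟨.seq M0 (.seq (.push 1 true) (.seq (.loop 1 body) M2)),
    p0 + (1 + (((X + 1) * N + 1) + p2.comp (3 * X + 1))), fun O u m hm hmu hO => ?_⟩
  have enc_pair : ∀ v, enc ((⟨u⟩, ⟨v⟩) : Word × Word) = pair u v := fun v => rfl
  have hlen : ∀ t ≤ m, (pair u t.bits).length ≤ 3 * u.length + 1 := fun t ht => by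
    rw [length_pair]
    have := length_bits_le t
    omega
  have pad : ∀ a : List Bool, st [a, []] = st [a] := fun a => st_append_nil [a]
  have key : ∀ d t, 0 < t → t + d = m → Exec O (.loop 1 body)
      (st [pair u t.bits, [true]]) (st [pair u m.bits]) ((d + 1) * N.eval u.length + 1) := by
    intro d
    induction d with
    | zero =>
      intro t ht htm
      obtain rfl : t = m := by omega
      have e1 := Exec.pop_st (O := O) (l := [pair u t.bits, [true]]) (r := 1) (by simp)
      have e2 := exec_dup (O := O) (pair u t.bits)
      have e3 := Exec.query_st (O := O) (l := [pair u t.bits, pair u t.bits]) (r := 1) (by simp)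
      have e4 := Exec.pop_st (O := O) (l := [pair u t.bits, [true]]) (r := 1) (by simp)
      have e5 : O (pair u t.bits) = [true] := by rw [hO t ht]; simp
      simp only [List.set_cons_succ, List.set_cons_zero, List.getElem_cons_succ,
        List.getElem_cons_zero, List.tail_cons, pad, e5] at e1 e3 e4
      refine Exec.mono (Exec.loop_step (by simp [st]) (e1.seq (e2.seq (e3.seq
        (Exec.branch_true rfl e4)))) (Exec.loop_exit rfl)) ?_
      have := hlen t le_rfl
      simp [N]
      omega
    | succ d ih =>
      intro t ht htm
      have e1 := Exec.pop_st (O := O) (l := [pair u t.bits, [true]]) (r := 1) (by simp)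
      have e2 := exec_dup (O := O) (pair u t.bits)
      have e3 := Exec.query_st (O := O) (l := [pair u t.bits, pair u t.bits]) (r := 1) (by simp)
      have e4 := Exec.pop_st (O := O) (l := [pair u t.bits, [false]]) (r := 1) (by simp)
      have e5 : O (pair u t.bits) = [false] := by
        rw [hO t ht, decide_eq_false]; omega
      have e6 := h1 O (⟨u⟩, ⟨t.bits⟩)
      rw [enc_pair, enc_pair] at e6
      dsimp only at e6
      rw [incBits_bits] at e6
      have e7 := Exec.push_st (O := O) (l := [pair u (t + 1).bits, []]) (r := 1) (by simp) true
      simp only [List.set_cons_succ, List.set_cons_zero, List.getElem_cons_succ,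
        List.getElem_cons_zero, List.tail_cons, pad, e5] at e1 e3 e4 e7
      refine Exec.mono (Exec.loop_step (by simp [st]) (e1.seq (e2.seq (e3.seq
        (Exec.branch_false rfl (e4.seq (e6.seq e7)))))) (ih (t + 1) (by omega) (by omega))) ?_
      have e8 := hlen t (by omega)
      have e9 := eval_mono p1 e8
      rw [add_mul (d + 1) 1, one_mul]
      simp [N] at e9 ⊢
      omega
  have e0 := h0 O ⟨u⟩
  rw [enc_pair] at e0
  have e1 := Exec.push_st (O := O) (l := [pair u [true], []]) (r := 1) (by simp) true
  simp only [List.set_cons_succ, List.set_cons_zero, List.getElem_cons_succ,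
    List.getElem_cons_zero, pad] at e1
  -- The search starts at 1, because the oracle is reliable only for positive bounds.
  have e2 := key (m - 1) 1 (by omega) (by omega)
  rw [Nat.one_bits] at e2
  have e3 := h2 O (⟨u⟩, ⟨m.bits⟩)
  rw [enc_pair] at e3
  refine (e0.seq (e1.seq (e2.seq e3))).mono ?_
  have e4 := eval_mono p2 (hlen m le_rfl)
  have e5 := Nat.mul_le_mul_right (N.eval u.length) (show m - 1 + 1 ≤ u.length + 1 by omega)
  simp only [eval_add, eval_mul, eval_comp, eval_X, eval_one, eval_ofNat, enc_word]
  omega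

end Complexity

namespace MinPM

open Complexity Enc

variable {F : Type*} [Field F] [Fintype F]

/-! ## Instances, solutions and certificates -/

section Tests

variable (e : Code F) (r : ℕ[X])

/-- Test whether a word encodes a list with nonzero last entry. -/
noncomputable def polyTest (w : List Bool) : Bool :=
  decide ((decodeList e w).flatMap (code e) = w) && !isZero (lastCoeff (decodeList e w))

/-- Test whether a word encodes an instance. -/
noncomputable def instTest (w : List Bool) : Bool :=
  decide (pair (unpair w).1 (unpair w).2 = w) && polyTest e (unpair w).1 &&
    (unpair w).2.reverse.headD true &&
    leBits true (decodeList e (unpair w).1).length.bits (unpair w).2 &&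
    leBits true (unpair w).2 (r.eval ((decodeList e (unpair w).1).length - 1)).bits

/-- Test whether `v` encodes a feasible solution of the instance encoded by `w`. -/
noncomputable def solTest (w v : List Bool) : Bool :=
  polyTest e v && leBits true (decodeList e v).length.bits (unpair w).2 &&
    dvdTest (decodeList e (unpair w).1) (decodeList e v)

/-- Test whether the first component of a word encodes an instance with a bound, and the second one
a feasible solution that satisfies the bound. -/
noncomputable def certTest (w : List Bool) : Bool :=
  decide (pair (unpair w).1 (unpair w).2 = w) &&
    decide (pair (unpair (unpair w).1).1 (unpair (unpair w).1).2 = (unpair w).1) &&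
    instTest e r (unpair (unpair w).1).1 && (unpair (unpair w).1).2.reverse.headD true &&
    solTest e (unpair (unpair w).1).1 (unpair w).2 &&
    leBits true (weight (decodeList e (unpair w).2)).bits (unpair (unpair w).1).2

section

variable {γ : Type*} [Enc γ]

@[fun_prop] theorem polyTime_flatMap_code {l : γ → List F} (hl : PolyTime l) :
    PolyTime (fun c => (l c).flatMap (code e)) := by
  have := PolyTime.of_finite enc_injective (code e)
  exact PolyTime.flatMap (f := fun x => code e x.2) hl (by fun_prop)

@[fun_prop] theorem polyTime_polyTest {w : γ → List Bool} (hw : PolyTime w) :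
    PolyTime (fun c => polyTest e (w c)) := by
  unfold polyTest; fun_prop

@[fun_prop] theorem polyTime_instTest {w : γ → List Bool} (hw : PolyTime w) :
    PolyTime (fun c => instTest e r (w c)) := by
  unfold instTest
  have := PolyTime.eval_nat r (n := fun c => (decodeList e (unpair (w c)).1).length - 1)
    (by fun_prop)
  fun_prop

@[fun_prop] theorem polyTime_solTest {w v : γ → List Bool} (hw : PolyTime w) (hv : PolyTime v) :
    PolyTime (fun c => solTest e (w c) (v c)) := by
  unfold solTest; fun_prop

theorem polyTime_certTest : PolyTime (fun w : Word => certTest e r w.bits) := by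
  unfold certTest; fun_prop

end

variable {e r}

/-- Decoding is total and returns arbitrary values on invalid input, so validity is tested by
encoding again and comparing. -/
theorem polyTest_iff (w : List Bool) :
    polyTest e w = true ↔ ∃ P : F[X], P ≠ 0 ∧ w = encPoly e P := by
  simp only [polyTest, isZero, Bool.and_eq_true, decide_eq_true_eq, Bool.not_eq_true',
    decide_eq_false_iff_not]
  constructor
  · rintro ⟨h1, h2⟩
    obtain ⟨h3, h4⟩ := coeffList_ofCoeffs h2
    exact ⟨_, h4, by rw [encPoly_eq, h3, h1]⟩
  · rintro ⟨P, hP, rfl⟩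
    rw [decodeList_encPoly, lastCoeff_coeffList]
    exact ⟨(encPoly_eq e P).symm, leadingCoeff_ne_zero.2 hP⟩

theorem encI_eq (x : (minPM e r).Instance) :
    (minPM e r).encI x = pair (encPoly e x.1.1) x.1.2.bits := rfl

/-- The coefficient list has `deg P + 1` entries, so comparing its length with `n` by `≤` expresses
`deg P < n`. The test of `pair` against `unpair` excludes words that are not pairs. -/
theorem instTest_iff (w : List Bool) :
    instTest e r w = true ↔ ∃ x, w = (minPM e r).encI x := by
  simp only [instTest, Bool.and_eq_true, decide_eq_true_eq, polyTest_iff, leBits_true,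
    ← exists_eq_bits_iff]
  constructor
  · rintro ⟨⟨⟨⟨h1, P, hP, h2⟩, n, h3⟩, h4⟩, h5⟩
    rw [h2, h3, decodeList_encPoly, length_coeffList, ofBits_bits, ofBits_bits] at h4 h5
    exact ⟨⟨(P, n), hP, by dsimp only; omega, by simpa using h5⟩, by
      change w = pair (encPoly e P) n.bits
      rw [← h1, h2, h3]⟩
  · rintro ⟨x, rfl⟩
    obtain ⟨hP, h1, h2⟩ := x.2
    rw [encI_eq, unpair_pair, decodeList_encPoly, length_coeffList, ofBits_bits, ofBits_bits,
      ofBits_bits]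
    exact ⟨⟨⟨⟨rfl, _, hP, rfl⟩, _, rfl⟩, h1⟩, by simpa using h2⟩

theorem solTest_iff (x : (minPM e r).Instance) (v : List Bool) :
    solTest e ((minPM e r).encI x) v = true ↔ ∃ K ∈ (minPM e r).Sol x, v = encPoly e K := by
  simp only [solTest, Bool.and_eq_true, polyTest_iff, leBits_true, decide_eq_true_eq, encI_eq,
    unpair_pair, ofBits_bits, decodeList_encPoly]
  have hx : lastCoeff (coeffList x.1.1) ≠ 0 := by
    rw [lastCoeff_coeffList]; exact leadingCoeff_ne_zero.2 x.2.1
  constructor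
  · rintro ⟨⟨⟨K, hK, rfl⟩, h1⟩, h2⟩
    rw [decodeList_encPoly] at h1 h2
    rw [dvdTest_iff hx, ofCoeffs_coeffList, ofCoeffs_coeffList] at h2
    rw [length_coeffList] at h1
    exact ⟨K, ⟨hK, h1, h2⟩, rfl⟩
  · rintro ⟨(K : F[X]), ⟨hK, h1, h2⟩, rfl⟩
    rw [decodeList_encPoly, dvdTest_iff hx, ofCoeffs_coeffList, ofCoeffs_coeffList,
      length_coeffList]
    exact ⟨⟨⟨K, hK, rfl⟩, h1⟩, h2⟩

theorem certTest_iff (w : List Bool) : certTest e r w = true ↔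
    ∃ x t, ∃ K ∈ (minPM e r).Sol x, (minPM e r).measure x K ≤ t ∧
      w = pair (pair ((minPM e r).encI x) t.bits) (encPoly e K) := by
  simp only [certTest, Bool.and_eq_true, decide_eq_true_eq, leBits_true, ← exists_eq_bits_iff,
    instTest_iff, ofBits_bits]
  constructor
  · rintro ⟨⟨⟨⟨⟨h1, h2⟩, x, h3⟩, t, h4⟩, h5⟩, h6⟩
    rw [h3, solTest_iff] at h5
    obtain ⟨(K : F[X]), hK, h5⟩ := h5
    rw [h5, h4, ofBits_bits, decodeList_encPoly, weight_coeffList] at h6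
    exact ⟨x, t, K, hK, h6, by rw [← h1, ← h2, h3, h4, h5]⟩
  · rintro ⟨x, t, (K : F[X]), hK, h, rfl⟩
    simp only [unpair_pair]
    rw [solTest_iff, decodeList_encPoly, weight_coeffList, ofBits_bits]
    exact ⟨⟨⟨⟨⟨trivial, trivial⟩, x, rfl⟩, t, rfl⟩, K, hK, rfl⟩, h⟩

/-! ## Optimal values -/

theorem natDegree_lt_length_encPoly (P : F[X]) : P.natDegree < (encPoly e P).length := by
  rw [encPoly_length]
  have hb : 0 < Nat.clog 2 (Fintype.card F) := Nat.clog_pos (by norm_num) Fintype.one_lt_card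
  have := Nat.le_mul_of_pos_right (P.natDegree + 1) hb
  omega

theorem natDegree_lt_length_encI (x : (minPM e r).Instance) :
    x.1.1.natDegree < ((minPM e r).encI x).length := by
  rw [encI_eq, length_pair]
  have := natDegree_lt_length_encPoly (e := e) x.1.1
  omega

/-- This is the role of `deg P < n`: an optimum exists, and the weight of `P` bounds it. -/
theorem self_mem_sol (x : (minPM e r).Instance) : x.1.1 ∈ (minPM e r).Sol x :=
  ⟨x.2.1, x.2.2.1, dvd_rfl⟩

theorem exists_isOptimal (x : (minPM e r).Instance) : ∃ K, (minPM e r).IsOptimal x K := by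
  obtain ⟨K, hK, h⟩ := (InvImage.wf ((minPM e r).measure x) Nat.lt_wfRel.wf).has_min
    ((minPM e r).Sol x) ⟨_, self_mem_sol x⟩
  exact ⟨K, hK, fun z hz => not_lt.1 (h z hz)⟩

theorem isOptValue_unique {x : (minPM e r).Instance} {m m' : ℕ}
    (h : (minPM e r).IsOptValue x m) (h' : (minPM e r).IsOptValue x m') : m = m' := by
  obtain ⟨K, hK, rfl⟩ := h
  obtain ⟨K', hK', rfl⟩ := h'
  exact le_antisymm (hK.2 _ hK'.1) (hK'.2 _ hK.1)

/-- The optimum is at most the weight of `P`, which is at most `deg P + 1`. Linear search for the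
optimum is therefore affordable. -/
theorem isOptValue_le {x : (minPM e r).Instance} {m : ℕ} (h : (minPM e r).IsOptValue x m) :
    m ≤ ((minPM e r).encI x).length := by
  obtain ⟨K, hK, rfl⟩ := h
  have h1 : (minPM e r).measure x K ≤ x.1.1.support.card := hK.2 _ (self_mem_sol x)
  have h2 := card_supp_le_succ_natDegree x.1.1
  have h3 := natDegree_lt_length_encI x
  omega

theorem isOptValue_pos {x : (minPM e r).Instance} {m : ℕ} (h : (minPM e r).IsOptValue x m) :
    0 < m := by
  obtain ⟨K, hK, rfl⟩ := h
  exact (minPM e r).measure_pos x K hK.1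

/-- The word determines the instance and the bound, and the instance determines its optimal value.
-/
theorem mem_language_iff {x : (minPM e r).Instance} {m : ℕ} (h : (minPM e r).IsOptValue x m)
    (t : ℕ) : pair ((minPM e r).encI x) t.bits ∈ (minPM e r).language ↔ m ≤ t := by
  constructor
  · rintro ⟨x', t', ⟨m', h1, h2⟩, h3⟩
    obtain ⟨h4, h5⟩ := pair_inj h3
    obtain rfl := (minPM e r).encI_injective h4
    obtain rfl := bits_injective h5
    rw [isOptValue_unique h h1]
    exact h2
  · exact fun ht => ⟨x, t, ⟨m, h, ht⟩, rfl⟩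

/-- Here the restriction `n ≤ r (deg P)` is essential: `K` has at most `n` coefficients, and `deg P`
is bounded by the size of the instance. -/
theorem length_encPoly_le {x : (minPM e r).Instance} {K : F[X]} (hK : K ∈ (minPM e r).Sol x) :
    (encPoly e K).length ≤ (r * C (Nat.clog 2 (Fintype.card F))).eval
      ((minPM e r).encI x).length := by
  rw [encPoly_length, eval_mul, eval_C]
  apply Nat.mul_le_mul_right
  have h1 : K.natDegree < x.1.2 := hK.2.1
  exact h1.trans_le (x.2.2.2.trans (eval_mono r (natDegree_lt_length_encI x).le))

end Tests

/-! ## The complexity of MIN-PM -/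

variable (e : Code F) (r : ℕ[X])

theorem isNPO : (minPM e r).IsNPO where
  instances := by
    have h : PolyTime (fun w : Word => instTest e r w.bits) := by fun_prop
    refine h.decision_solvable fun w _ => ?_
    rw [instTest_iff]
    exact exists_congr fun x => eq_comm
  solutions := by
    refine ⟨r * C (Nat.clog 2 (Fintype.card F)), fun x y hy => length_encPoly_le hy, ?_⟩
    have h : PolyTime (fun w : Word => solTest e (unpair w.bits).1 (unpair w.bits).2) := by fun_prop
    refine h.decision_solvable ?_
    rintro _ ⟨x, v, _, rfl⟩
    rw [unpair_pair, solTest_iff]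
    constructor
    · rintro ⟨K, hK, rfl⟩
      exact ⟨x, K, hK, rfl⟩
    · rintro ⟨x', K, hK, h1⟩
      obtain ⟨h2, h3⟩ := pair_inj h1
      obtain rfl := (minPM e r).encI_injective h2
      exact ⟨K, hK, h3⟩
  measure_computable := by
    have h : PolyTime (fun w : Word =>
      Word.mk (weight (decodeList e (unpair w.bits).2)).bits) := by fun_prop
    refine h.solvable ?_
    rintro _ ⟨x, (K : F[X]), hK, rfl⟩
    refine ⟨x, K, hK, rfl, ?_⟩
    have e1 : (minPM e r).encS K = encPoly e K := rfl
    rw [enc_word, unpair_pair, e1, decodeList_encPoly, weight_coeffList]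
    rfl

/-- The certificate is a feasible `K` of weight at most `t`. It need not be optimal, since any such
`K` bounds the optimum. -/
theorem language_inNP : InNP (minPM e r).language := by
  refine ⟨r * C (Nat.clog 2 (Fintype.card F)), {w | certTest e r w = true},
    (polyTime_certTest e r).decision_solvable fun w _ => Iff.rfl, fun w => ?_⟩
  simp only [Set.mem_ofPred_eq, certTest_iff]
  constructor
  · rintro ⟨x, t, ⟨m, ⟨K, hK, rfl⟩, ht⟩, rfl⟩
    refine ⟨encPoly e K, (length_encPoly_le hK.1).trans (eval_mono _ ?_), x, t, K, hK.1, ht, rfl⟩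
    rw [length_pair]
    omega
  · rintro ⟨c, -, x, t, K, hK, h1, h2⟩
    obtain ⟨rfl, -⟩ := pair_inj h2
    obtain ⟨K', hK'⟩ := exists_isOptimal x
    exact ⟨x, t, ⟨_, ⟨K', hK', rfl⟩, (hK'.2 K hK).trans h1⟩, rfl⟩

/-- One query and a binary comparison; the answer is no longer than the instance, whence the bound
`X`. -/
theorem decision_reducible_evaluation :
    (minPM e r).decision.TuringReducible (minPM e r).evaluation := by
  obtain ⟨M, p, h⟩ := exists_query_program
    (g := fun x : Word × Word => leBits true x.2.bits x.1.bits) (by fun_prop) X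
  refine ⟨M, p, fun O hO w hw => ⟨_, rfl, ?_⟩⟩
  obtain ⟨x, t, ht, rfl⟩ := hw
  obtain ⟨x', m, h1, h2, h3⟩ := hO ((minPM e r).encI x) ⟨x, exists_isOptimal x, rfl⟩
  obtain rfl := (minPM e r).encI_injective h1
  have h4 := h O ((minPM e r).encI x) t.bits (by
    rw [h3, eval_X]
    exact (length_bits_le m).trans (isOptValue_le h2))
  have h5 := h4.outputs
  rw [h3] at h5
  convert h5 using 2
  rw [leBits_true, ofBits_bits, ofBits_bits, decide_eq_decide]
  exact mem_language_iff h2 t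

theorem decision_reducible_constructive :
    (minPM e r).decision.TuringReducible (minPM e r).constructive := by
  obtain ⟨M, p, h⟩ := exists_query_program
    (g := fun x : Word × Word => leBits true (unpair x.2.bits).2 x.1.bits) (by fun_prop)
    -- Length of the answer: `pair` doubles the code of the solution and adds one separator bit; the
    -- measure needs at most `X` bits.
    (2 * (r * C (Nat.clog 2 (Fintype.card F))) + X + 1)
  refine ⟨M, p, fun O hO w hw => ⟨_, rfl, ?_⟩⟩
  obtain ⟨x, t, ht, rfl⟩ := hw
  obtain ⟨x', K, h1, h2, h3⟩ := hO ((minPM e r).encI x) ⟨x, exists_isOptimal x, rfl⟩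
  obtain rfl := (minPM e r).encI_injective h1
  have h4 := h O ((minPM e r).encI x) t.bits (by
    rw [h3, length_pair, eval_add, eval_add, eval_mul, eval_X, eval_one, eval_ofNat]
    have e1 : (minPM e r).encS K = encPoly e K := rfl
    have e2 := length_encPoly_le h2.1
    have e3 := (length_bits_le _).trans (isOptValue_le ⟨K, h2, rfl⟩)
    rw [e1]
    omega)
  have h5 := h4.outputs
  rw [h3, unpair_pair] at h5
  convert h5 using 2
  rw [leBits_true, ofBits_bits, ofBits_bits, decide_eq_decide]
  exact mem_language_iff ⟨K, h2, rfl⟩ t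

/-- The answer already contains the measure as its second component, so projecting it suffices. -/
theorem evaluation_reducible_constructive :
    (minPM e r).evaluation.TuringReducible (minPM e r).constructive := by
  obtain ⟨M, p, -, h⟩ := PolyTime.unpairWord.2
  let q : ℕ[X] := 2 * (r * C (Nat.clog 2 (Fintype.card F))) + X + 1
  refine ⟨.seq (.query 0) M, (1 + q) + p.comp q, fun O hO w hw => ?_⟩
  obtain ⟨x', K, rfl, h2, h3⟩ := hO w hw
  refine ⟨_, ⟨x', _, rfl, ⟨K, h2, rfl⟩, rfl⟩, ?_⟩
  have h4 := Exec.query_st (O := O) (l := [(minPM e r).encI x']) (r := 0) (by simp)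
  have h5 := h O ⟨O ((minPM e r).encI x')⟩
  refine Exec.outputs (l := []) ?_
  have h6 := h4.seq h5
  have h7 : (O ((minPM e r).encI x')).length ≤ q.eval ((minPM e r).encI x').length := by
    rw [h3, length_pair, eval_add, eval_add, eval_mul, eval_X, eval_one, eval_ofNat]
    have e1 : (minPM e r).encS K = encPoly e K := rfl
    have e2 := length_encPoly_le h2.1
    have e3 := (length_bits_le _).trans (isOptValue_le ⟨K, h2, rfl⟩)
    rw [e1]
    omega
  have h8 := eval_mono p h7
  simp only [enc_word, List.getElem_cons_zero] at h6
  have h9 := h6.mono (T' := ((1 + q) + p.comp q).eval ((minPM e r).encI x').length) (by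
    simp only [eval_add, eval_one, eval_comp]
    omega)
  simpa only [h3, unpair_pair] using h9

/-- The search is exact because the oracle accepts a positive `t` precisely when the optimum is at
most `t`, and the optimum is positive. -/
theorem evaluation_reducible_decision :
    (minPM e r).evaluation.TuringReducible (minPM e r).decision := by
  obtain ⟨M, p, h⟩ := exists_search_program
  refine ⟨M, p, fun O hO w hw => ?_⟩
  obtain ⟨x, ⟨K, hK⟩, rfl⟩ := hw
  have h1 : (minPM e r).IsOptValue x ((minPM e r).measure x K) := ⟨K, hK, rfl⟩
  refine ⟨_, ⟨x, _, rfl, h1, rfl⟩, Exec.outputs (l := []) ?_⟩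
  refine h O _ _ (isOptValue_pos h1) (isOptValue_le h1) fun t ht => ?_
  have h2 := hO (pair ((minPM e r).encI x) t.bits) ⟨x, t, ht, rfl⟩
  rw [show O (pair ((minPM e r).encI x) t.bits) = _ from h2]
  congr 1
  rw [decide_eq_decide]
  exact mem_language_iff h1 t

end MinPM

theorem mainTheorem2 {F : Type*} [Field F] [Fintype F] (e : MinPM.Code F) (r : Polynomial ℕ) :
    (MinPM.minPM e r).IsNPO ∧
    ((MinPM.minPM e r).decision.TuringEquivalent (MinPM.minPM e r).evaluation ∧
      (MinPM.minPM e r).evaluation.TuringReducible (MinPM.minPM e r).constructive ∧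
      (MinPM.minPM e r).decision.TuringReducible (MinPM.minPM e r).constructive) ∧
    Complexity.InNP (MinPM.minPM e r).language :=
  ⟨MinPM.isNPO e r,
    ⟨⟨MinPM.decision_reducible_evaluation e r, MinPM.evaluation_reducible_decision e r⟩,
      MinPM.evaluation_reducible_constructive e r, MinPM.decision_reducible_constructive e r⟩,
    MinPM.language_inNP e r⟩
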